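/- **Theorem (asymptotic $L^p$ moments of $\hat r_\phi$).** Let $m\ge 1$, let $X,Z$ be random vectors in $\mathbb R^d$ with supports $\mathcal X$ and $\mathcal Z\subset\mathcal X$, and let $\phi:\mathcal X\to\mathbb R^m$ be measurable. Suppose that the laws $\nu_0$ of $\phi(X)$ and $\nu_1$ of $\phi(Z)$ have densities $f_0,f_1$ with respect to Lebesgue measure on $\mathbb R^m$ and that $\nu_1\ll\nu_0$; put $r=f_1/f_0$. Let $X_1,\dots,X_{N_0}$ be independent copies of $X$ and $Z_1,\dots,Z_{N_1}$ independent copies of $Z$, all mutually independent. Let $N_1=N_1(N_0)$ and $M=M(N_0)$ be sequences of nonnegative integers. For $x\in\mathcal X$ let $\hat\phi$ be an estimator of the function $\phi$, that is, a (jointly measurable) function of the evaluation point and the data $X_1,\dots,X_{N_0},Z_1,\dots,Z_{N_1}$, which may also depend on $x$. Let $\hat\Phi_M(z)$ be the $M$-th smallest of $\|\hat\phi(X_i)-\hat\phi(z)\|$, $i=1,\dots,N_0$, and put $$A_\phi(x)=\{z\in\mathcal Z:\|\hat\phi(x)-\hat\phi(z)\|\le\hat\Phi_M(z)\},\qquad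 K_\phi(x)=\sum_{j=1}^{N_1}\mathbf 1(Z_j\in A_\phi(x)),\qquad \hat r_\phi(x)=\frac{N_0}{N_1}\frac{K_\phi(x)}{M}.$$ Let $p\ge1$ be an integer. For $z\in\mathcal Z^p$ let $\hat\phi_{(Z_1,\dots,Z_p)\to z}$ be the estimator computed after replacing $(Z_1,\dots,Z_p)$ by $z$, and write $\|\psi\|_\infty=\sup_{s\in\mathcal X}\|\psi(s)\|$. Assume that one of the following holds. (a) For some integer $q$ with $1\le q\le m$ (for instance $q=m$), $$\lim_{N_0\to\infty}E\Big[\Big(\frac{N_0}{M}\Big)^p\sup_{z\in\mathcal Z^p}\|\hat\phi_{(Z_1,\dots,Z_p)\to z}-\phi\|_\infty^{pq}\Big]=0 .$$ (b) For every $\epsilon>0$ there are functions $T_\epsilon=T_{\epsilon,N_0}:(0,\infty)\to[0,\infty]$ such that for all $u>0$ and all $N_0$ $$P\Big(\sup_{\delta\ge u}\delta^{-1}\sup_{s,t\in\mathcal X:\|\phi(s)-\phi(t)\|\le\delta}\ \sup_{z\in\mathcal Z^p}\|(\hat\phi_{(Z_1,\dots,Z_p)\to z}-\phi)(s)-(\hat\phi_{(Z_1,\dots,Z_p)\to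 z}-\phi)(t)\|>\epsilon\Big)\le T_\epsilon(u),$$ $$\lim_{N_0\to\infty}\Big(\frac{N_0}{M}\Big)^k\int_0^\infty u^{k-1}T_\epsilon(u^{1/m})\,du=0\quad(k=1,\dots,p),\qquad \lim_{N_0\to\infty}\Big(\frac{N_0}{M}\Big)^pP\big(\|\hat\phi-\phi\|_\infty>\epsilon\big)=0 .$$ If $M\log N_0/N_0\to0$, $MN_1/N_0\to\infty$ and $M\to\infty$ as $N_0\to\infty$, then $$\lim_{N_0\to\infty}E\big[\hat r_\phi(x)^p\big]=r(\phi(x))^p$$ for every $x\in\mathcal X$ such that $f_0(\phi(x))>0$ and $f_0,f_1$ are continuous at $\phi(x)$. -/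

import Mathlib

open MeasureTheory ProbabilityTheory Filter Topology
open scoped ENNReal NNReal

namespace MatchingRatio

noncomputable section

/-- The Euclidean space `ℝᵏ`. -/
abbrev E (k : ℕ) : Type := EuclideanSpace ℝ (Fin k)

/-- The `k`-th order statistic (`k`-th smallest entry, `1 ≤ k ≤ N`, counted with multiplicity)
of a finite real sample. Outside the range `1 ≤ k ≤ N` the value is irrelevant. -/
def orderStat {N : ℕ} (v : Fin N → ℝ) (k : ℕ) : ℝ :=
  if h : k - 1 < N then v (Tuple.sort v ⟨k - 1, h⟩) else 0

/-- The sample `zs` in which the first `p` observations are replaced by the points `z`. -/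
def replaceFirst {α : Type*} {N p : ℕ} (zs : Fin N → α) (z : Fin p → α) : Fin N → α :=
  fun j => if h : (j : ℕ) < p then z ⟨j, h⟩ else zs j

variable {d m : ℕ}

/-- The radius `Φ̂_M(z)`: the `M`-th order statistic of the distances `‖φ̂(Xᵢ) - φ̂(z)‖`,
`i = 1, …, N₀`. -/
def matchRadius {N₀ : ℕ} (M : ℕ) (φh : E d → E m) (xs : Fin N₀ → E d) (z : E d) : ℝ :=
  orderStat (fun i => ‖φh (xs i) - φh z‖) M

/-- The catchment area of `x`, a subset of `𝒵`. -/
def catchment {N₀ : ℕ} (𝒵 : Set (E d)) (M : ℕ) (φh : E d → E m) (xs : Fin N₀ → E d) (x : E d) :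
    Set (E d) :=
  {z | z ∈ 𝒵 ∧ ‖φh x - φh z‖ ≤ matchRadius M φh xs z}

/-- The number of matched times of `x`. -/
def matchCount {N₀ N₁ : ℕ} (𝒵 : Set (E d)) (M : ℕ) (φh : E d → E m)
    (xs : Fin N₀ → E d) (zs : Fin N₁ → E d) (x : E d) : ℝ :=
  ∑ j, (catchment 𝒵 M φh xs x).indicator (fun _ => (1 : ℝ)) (zs j)

/-- The matching-based density ratio estimator `(N₀ / N₁) * (K(x) / M)`. -/
def ratioEst {N₀ N₁ : ℕ} (𝒵 : Set (E d)) (M : ℕ) (φh : E d → E m)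
    (xs : Fin N₀ → E d) (zs : Fin N₁ → E d) (x : E d) : ℝ :=
  (N₀ : ℝ) / N₁ * (matchCount 𝒵 M φh xs zs x / M)

/-- An estimation procedure: for each `N₀` and each pair of samples of sizes `N₀` and `N₁(N₀)`,
a transformation of the covariates. -/
abbrev Estimator (d m : ℕ) (N₁ : ℕ → ℕ) : Type :=
  (n : ℕ) → (Fin n → E d) → (Fin (N₁ n) → E d) → E d → E m

/-- The supremum norm `‖ψ - φ‖_∞` over `𝒳`, with values in `[0, ∞]`. -/
def supDist (𝒳 : Set (E d)) (ψ φ : E d → E m) : ℝ≥0∞ :=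
  ⨆ s ∈ 𝒳, ‖ψ s - φ s‖ₑ

section

variable {Ω : Type*} [MeasurableSpace Ω] {N₁ : ℕ → ℕ}

/-- The fitted transformation on the samples `X₁, …, X_{N₀}` and `Z₁, …, Z_{N₁}`. -/
def fitted (φhat : Estimator d m N₁) (X Z : ℕ → Ω → E d) (n : ℕ) (ω : Ω) : E d → E m :=
  φhat n (fun i => X i ω) (fun j => Z j ω)

/-- The fitted transformation after replacing `(Z₁, …, Z_p)` by `z`. -/
def refitted (φhat : Estimator d m N₁) (X Z : ℕ → Ω → E d) {p : ℕ} (z : Fin p → E d)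
    (n : ℕ) (ω : Ω) : E d → E m :=
  φhat n (fun i => X i ω) (replaceFirst (fun j => Z j ω) z)

/-- `sup_{z ∈ 𝒵ᵖ} ‖φ̂_{(Z₁, …, Z_p) → z} - φ‖_∞`. -/
def supError (𝒳 𝒵 : Set (E d)) (φ : E d → E m) (φhat : Estimator d m N₁) (X Z : ℕ → Ω → E d)
    (p n : ℕ) (ω : Ω) : ℝ≥0∞ :=
  ⨆ z : Fin p → E d, ⨆ _ : ∀ k, z k ∈ 𝒵, supDist 𝒳 (refitted φhat X Z z n ω) φ

/-- `E[(N₀/M)ᵖ sup_{z ∈ 𝒵ᵖ} ‖φ̂_{(Z₁, …, Z_p) → z} - φ‖_∞^{pq}] → 0` as `N₀ → ∞`. -/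
def UniformErrorCondition (P : Measure Ω) (𝒳 𝒵 : Set (E d)) (φ : E d → E m)
    (φhat : Estimator d m N₁) (X Z : ℕ → Ω → E d) (M : ℕ → ℕ) (p q : ℕ) : Prop :=
  (∀ n, AEMeasurable (supError 𝒳 𝒵 φ φhat X Z p n) P) ∧
  Tendsto (fun n : ℕ =>
      ∫⁻ ω, ENNReal.ofReal ((n : ℝ) / M n) ^ p * supError 𝒳 𝒵 φ φhat X Z p n ω ^ (p * q) ∂P)
    atTop (𝓝 0)

/-- `sup_{δ ≥ u} δ⁻¹ sup_{s,t ∈ 𝒳 : ‖φ(s) - φ(t)‖ ≤ δ} sup_{z ∈ 𝒵ᵖ}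
‖(φ̂_{(Z₁, …, Z_p) → z} - φ)(s) - (φ̂_{(Z₁, …, Z_p) → z} - φ)(t)‖`. -/
def relOscillation (𝒳 𝒵 : Set (E d)) (φ : E d → E m) (φhat : Estimator d m N₁)
    (X Z : ℕ → Ω → E d) (p n : ℕ) (u : ℝ) (ω : Ω) : ℝ≥0∞ :=
  ⨆ δ : ℝ, ⨆ _ : u ≤ δ, ENNReal.ofReal δ⁻¹ *
    ⨆ s ∈ 𝒳, ⨆ t ∈ 𝒳, ⨆ _ : ‖φ s - φ t‖ ≤ δ,
      ⨆ z : Fin p → E d, ⨆ _ : ∀ k, z k ∈ 𝒵,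
        ‖(refitted φhat X Z z n ω s - φ s) - (refitted φhat X Z z n ω t - φ t)‖ₑ

/-- For every `ε > 0`: the relative oscillation exceeds `ε` with probability at most `T_ε(u)`, where
`(N₀/M)ᵏ ∫₀^∞ u^{k-1} T_ε(u^{1/m}) du → 0` for `1 ≤ k ≤ p` (the function `T_ε` may depend on `N₀`),
and `(N₀/M)ᵖ P(‖φ̂ - φ‖_∞ > ε) → 0`. -/
def OscillationCondition (P : Measure Ω) (𝒳 𝒵 : Set (E d)) (φ : E d → E m)
    (φhat : Estimator d m N₁) (X Z : ℕ → Ω → E d) (M : ℕ → ℕ) (p : ℕ) : Prop :=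
  ∀ ε : ℝ, 0 < ε →
    (∃ T : ℕ → ℝ → ℝ≥0∞,
      (∀ n, ∀ u : ℝ, 0 < u →
        P {ω | ENNReal.ofReal ε < relOscillation 𝒳 𝒵 φ φhat X Z p n u ω} ≤ T n u) ∧
      ∀ k ∈ Finset.Icc 1 p,
        Tendsto (fun n : ℕ => ENNReal.ofReal ((n : ℝ) / M n) ^ k *
            ∫⁻ u in Set.Ioi (0 : ℝ), ENNReal.ofReal (u ^ (k - 1)) * T n (u ^ (1 / (m : ℝ))))
          atTop (𝓝 0)) ∧
    Tendsto (fun n : ℕ => ENNReal.ofReal ((n : ℝ) / M n) ^ p *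
        P {ω | ENNReal.ofReal ε < supDist 𝒳 (fitted φhat X Z n ω) φ})
      atTop (𝓝 0)

end

end

end MatchingRatio

/-!
Let `h` be the radius for which the ball of radius `h` around `φ x` is expected to contain `M` of
the points `φ (X i)`. The estimation error enters only through increments of `ψ - φ`, where `ψ` is
the fitted transformation: if they are small compared with `r` on pairs of points whose `φ`-images
are within `r` of each other, and the balls of radius of order `r` around a finite net contain at
least `M` of the points `φ (X i)`, then no `z` with `φ z` at distance between `r` and `2 * r` from
`φ x` is matched to `x`.

For consistency this is applied with a fine net at scale `h`. By the weak law of large numbers the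
catchment area of `x` lies, with probability tending to one, between the `φ`-preimages of the balls
of radii `(1 - 4 * η) * h` and `(1 + 4 * η) * h`, and each of these contains a fraction close to
`f₁ (φ x) / f₀ (φ x) * M / n` of the points `Z j`.

For domination, the event that the argument fails at scale `2 ^ i * h` costs a count of the `Z j`
in a ball of radius of order `2 ^ i * h`, which is of order `2 ^ (i * m * p)` after normalization
and taking the `p`-th power. Both error conditions, and the Chernoff bound for the counts of the
`X i`, make the sum over `i` of these costs times the failure probabilities vanish. Hence the
`p`-th powers exceed a constant only by an amount that vanishes in mean, and convergence in
probability implies convergence of the `p`-th moments.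
-/

namespace MatchingRatio

noncomputable section

section Hits

variable {ι F G : Type*} [Fintype ι]

open Classical in
/-- The number of entries of a finite sample that fall in a set. -/
def hits (B : Set F) (v : ι → F) : ℕ :=
  (Finset.univ.filter fun i => v i ∈ B).card

lemma hits_le_hits {B : Set F} {C : Set G} {v : ι → F} {w : ι → G}
    (h : ∀ i, v i ∈ B → w i ∈ C) : hits B v ≤ hits C w := by
  classical exact Finset.card_le_card (Finset.monotone_filter_right _ fun i _ => h i)

lemma hits_le_card (B : Set F) (v : ι → F) : hits B v ≤ Fintype.card ι := by
  classical exact Finset.card_filter_le _ _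

lemma cast_hits (B : Set F) (v : ι → F) :
    (hits B v : ℝ) = ∑ i, B.indicator (1 : F → ℝ) (v i) := by
  classical simp [hits, Set.indicator_apply]

lemma measurable_hits [MeasurableSpace F] [MeasurableSpace G] {B : Set F} (hB : MeasurableSet B)
    {v : G → ι → F} (hv : Measurable v) : Measurable fun g => (hits B (v g) : ℝ) := by
  simp_rw [cast_hits]
  exact Finset.measurable_sum _ fun i _ =>
    (measurable_one.indicator hB).comp ((measurable_pi_apply i).comp hv)

lemma le_orderStat_iff {N : ℕ} (v : Fin N → ℝ) {k : ℕ} (hk : 1 ≤ k) (hkN : k ≤ N) (a : ℝ) :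
    a ≤ orderStat v k ↔ hits (Set.Iio a) v < k := by
  classical
  have hsorted : hits (Set.Iio a) v =
      (Finset.univ.filter fun j => (v ∘ Tuple.sort v) j < a).card := by
    refine (Finset.card_bij (fun j _ => Tuple.sort v j) ?_ ?_ ?_).symm
    · simp
    · exact fun _ _ _ _ h => (Tuple.sort v).injective h
    · exact fun i hi => ⟨(Tuple.sort v).symm i, by simpa using hi, by simp⟩
  have hlt := Tuple.lt_card_lt_iff_apply_lt_of_monotone (a := a)
    (j := ⟨k - 1, by omega⟩) (Tuple.monotone_sort v)
  rw [hsorted, orderStat, dif_pos (by omega), ← not_lt]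
  exact (not_congr hlt.symm).trans (by simp only; omega)

end Hits

/-- An independent family of random elements with common law `ν`. -/
structure IsIIDSample {ι Ω F : Type*} [MeasurableSpace Ω] [MeasurableSpace F] (Y : ι → Ω → F)
    (ν : Measure F) (P : Measure Ω) : Prop where
  hasLaw : ∀ i, HasLaw (Y i) ν P
  iIndepFun : iIndepFun Y P

section Counts

variable {Ω F G ι κ : Type*} [MeasurableSpace Ω] [MeasurableSpace F] [MeasurableSpace G]
  {P : Measure Ω} {ν : Measure F}

lemma IsIIDSample.comp {Y : ι → Ω → F} (hY : IsIIDSample Y ν P) {g : F → G} (hg : Measurable g) :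
    IsIIDSample (fun i => g ∘ Y i) (ν.map g) P where
  hasLaw i := HasLaw.comp ⟨hg.aemeasurable, rfl⟩ (hY.hasLaw i)
  iIndepFun := hY.iIndepFun.comp _ fun _ => hg

lemma IsIIDSample.precomp {Y : ι → Ω → F} (hY : IsIIDSample Y ν P) {g : κ → ι}
    (hg : Function.Injective g) : IsIIDSample (fun k => Y (g k)) ν P where
  hasLaw k := hY.hasLaw (g k)
  iIndepFun := hY.iIndepFun.precomp hg

lemma IsIIDSample.take {Y : ℕ → Ω → F} (hY : IsIIDSample Y ν P) (N : ℕ) :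
    IsIIDSample (fun i : Fin N => Y i) ν P :=
  hY.precomp Fin.val_injective

variable {B : Set F}

lemma integral_indicator_one_hasLaw {Y : Ω → F} (hY : HasLaw Y ν P) (hB : MeasurableSet B) :
    ∫ ω, B.indicator (1 : F → ℝ) (Y ω) ∂P = ν.real B :=
  (hY.integral_comp (measurable_one.indicator hB).aestronglyMeasurable).trans
    (integral_indicator_one hB)

variable [IsProbabilityMeasure P] {N : ℕ} {Y : Fin N → Ω → F}

lemma memLp_indicator_one_hasLaw {Y : Ω → F} (hY : HasLaw Y ν P) (hB : MeasurableSet B)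
    (p : ℝ≥0∞) : MemLp (B.indicator (1 : F → ℝ) ∘ Y) p P :=
  MemLp.of_bound
    ((measurable_one.indicator hB).comp_aemeasurable hY.aemeasurable).aestronglyMeasurable 1
    (Eventually.of_forall fun ω => by by_cases h : Y ω ∈ B <;> simp [h])

lemma integrable_exp_hits (hY : IsIIDSample Y ν P) (hB : MeasurableSet B) (s : ℝ) :
    Integrable (fun ω => Real.exp (s * hits B fun i => Y i ω)) P := by
  have hmeas : AEMeasurable (fun ω => (hits B fun i => Y i ω : ℝ)) P :=
    (measurable_hits hB measurable_id).comp_aemeasurable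
      (aemeasurable_pi_lambda _ fun i => (hY.hasLaw i).aemeasurable)
  refine Integrable.of_bound (C := Real.exp (|s| * N))
    (Real.measurable_exp.comp_aemeasurable (hmeas.const_mul s)).aestronglyMeasurable
    (Eventually.of_forall fun ω => ?_)
  rw [Real.norm_eq_abs, Real.abs_exp, Real.exp_le_exp]
  refine (le_abs_self _).trans ?_
  rw [abs_mul, Nat.abs_cast]
  gcongr
  exact (hits_le_card _ _).trans_eq (Fintype.card_fin N)

lemma mgf_indicator_one_hasLaw {Y : Ω → F} (hY : HasLaw Y ν P) (hB : MeasurableSet B) (s : ℝ) :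
    mgf (B.indicator (1 : F → ℝ) ∘ Y) P s = 1 + ν.real B * (Real.exp s - 1) := by
  have hexp : ∀ ω, Real.exp (s * (B.indicator (1 : F → ℝ) ∘ Y) ω) =
      1 + B.indicator (1 : F → ℝ) (Y ω) * (Real.exp s - 1) := fun ω => by
    by_cases h : Y ω ∈ B <;> simp [h]
  have hint : Integrable (fun ω => B.indicator (1 : F → ℝ) (Y ω)) P :=
    memLp_one_iff_integrable.1 (memLp_indicator_one_hasLaw hY hB 1)
  simp_rw [mgf, hexp]
  rw [integral_add (integrable_const _) (hint.mul_const _), integral_mul_const,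
    integral_indicator_one_hasLaw hY hB]
  simp

lemma mgf_hits_le (hY : IsIIDSample Y ν P) (hB : MeasurableSet B) (s : ℝ) :
    mgf (fun ω => (hits B fun i => Y i ω : ℝ)) P s ≤
      Real.exp (N * ν.real B * (Real.exp s - 1)) := by
  have hI : Measurable (B.indicator (1 : F → ℝ)) := measurable_one.indicator hB
  have hsum : (fun ω => (hits B fun i => Y i ω : ℝ)) = ∑ i, B.indicator (1 : F → ℝ) ∘ Y i := by
    ext ω
    simp [cast_hits]
  rw [hsum, (hY.comp hI).iIndepFun.mgf_sum₀ fun i => ((hY.comp hI).hasLaw i).aemeasurable]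
  calc ∏ i, mgf (B.indicator (1 : F → ℝ) ∘ Y i) P s
      ≤ ∏ _i : Fin N, Real.exp (ν.real B * (Real.exp s - 1)) := by
        refine Finset.prod_le_prod (fun i _ => mgf_nonneg) fun i _ => ?_
        rw [mgf_indicator_one_hasLaw (hY.hasLaw i) hB, add_comm]
        exact Real.add_one_le_exp _
    _ = Real.exp (N * ν.real B * (Real.exp s - 1)) := by
        rw [Finset.prod_const, Finset.card_univ, Fintype.card_fin, ← Real.exp_nat_mul, mul_assoc]

lemma measure_hits_lt_le (hY : IsIIDSample Y ν P) (hB : MeasurableSet B) (k : ℕ) :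
    P {ω | hits B (fun i => Y i ω) < k} ≤
      ENNReal.ofReal (Real.exp (k - N * ν.real B / 2)) := by
  have hexp : Real.exp (-1) ≤ 1 / 2 := by
    linarith [Real.exp_neg_one_lt_d9]
  have hchernoff : P.real {ω | (hits B (fun i => Y i ω) : ℝ) ≤ k} ≤
      Real.exp (k - N * ν.real B / 2) := by
    refine (measure_le_le_exp_mul_mgf (t := -1) k (by norm_num)
      (integrable_exp_hits hY hB _)).trans ?_
    refine (mul_le_mul_of_nonneg_left (mgf_hits_le hY hB _) (Real.exp_pos _).le).trans ?_
    rw [← Real.exp_add, Real.exp_le_exp]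
    have hmean : 0 ≤ N * ν.real B := by positivity
    nlinarith
  rw [← ofReal_measureReal]
  refine ENNReal.ofReal_le_ofReal (le_trans (measureReal_mono fun ω hω => ?_) hchernoff)
  exact Nat.cast_le (α := ℝ).2 (le_of_lt hω)

lemma lintegral_hits_tsub_pow_le (hY : IsIIDSample Y ν P) (hB : MeasurableSet B) {p : ℕ}
    (hp : p ≠ 0) {l : ℝ} (hl : N * ν.real B ≤ l / 4) :
    ∫⁻ ω, ((hits B fun i => Y i ω : ℝ≥0∞) - ENNReal.ofReal l) ^ p ∂P ≤
      ENNReal.ofReal (p.factorial * Real.exp (-(l / 2))) := by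
  have hpt : ∀ k : ℕ, ((k : ℝ≥0∞) - ENNReal.ofReal l) ^ p ≤
      ENNReal.ofReal (p.factorial * Real.exp (-l) * Real.exp (1 * k)) := by
    intro k
    have hl0 : 0 ≤ l := by linarith [show 0 ≤ N * ν.real B by positivity]
    rw [← ENNReal.ofReal_natCast k, ← ENNReal.ofReal_sub _ hl0, mul_assoc, ← Real.exp_add]
    rcases le_total (k - l) 0 with h | h
    · simp [ENNReal.ofReal_of_nonpos h, hp]
    · rw [← ENNReal.ofReal_pow h]
      rw [one_mul, neg_add_eq_sub]
      exact ENNReal.ofReal_le_ofReal <|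
        (div_le_iff₀' (by positivity)).1 (Real.pow_div_factorial_le_exp _ h p)
  refine (lintegral_mono fun ω => hpt _).trans ?_
  rw [← ofReal_integral_eq_lintegral_ofReal ((integrable_exp_hits hY hB 1).const_mul _)
    (Eventually.of_forall fun ω => by positivity), integral_const_mul, mul_assoc]
  refine ENNReal.ofReal_le_ofReal (mul_le_mul_of_nonneg_left ?_ (by positivity))
  refine (mul_le_mul_of_nonneg_left (mgf_hits_le hY hB 1) (Real.exp_pos _).le).trans ?_
  rw [← Real.exp_add, Real.exp_le_exp]
  have hmean : 0 ≤ N * ν.real B := by positivity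
  nlinarith [Real.exp_one_lt_d9]

lemma variance_hits_le (hY : IsIIDSample Y ν P) (hB : MeasurableSet B) :
    variance (fun ω => (hits B fun i => Y i ω : ℝ)) P ≤ N * ν.real B := by
  have hL : ∀ i, MemLp (B.indicator (1 : F → ℝ) ∘ Y i) 2 P := fun i =>
    memLp_indicator_one_hasLaw (hY.hasLaw i) hB 2
  have hvar : ∀ i, variance (B.indicator (1 : F → ℝ) ∘ Y i) P ≤ ν.real B := by
    intro i
    refine (variance_le_expectation_sq (hL i).aestronglyMeasurable).trans_eq ?_
    rw [← integral_indicator_one_hasLaw (hY.hasLaw i) hB]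
    refine integral_congr_ae (Eventually.of_forall fun ω => ?_)
    by_cases h : Y i ω ∈ B <;> simp [h]
  have hsum : (fun ω => (hits B fun i => Y i ω : ℝ)) = ∑ i, B.indicator (1 : F → ℝ) ∘ Y i := by
    ext ω
    simp [cast_hits]
  rw [hsum, IndepFun.variance_sum (fun i _ => hL i) fun i _ j _ hij =>
    (hY.comp (measurable_one.indicator hB)).iIndepFun.indepFun hij]
  exact (Finset.sum_le_sum fun i _ => hvar i).trans_eq (by simp)

lemma measure_abs_hits_sub_ge_le (hY : IsIIDSample Y ν P) (hB : MeasurableSet B) {δ : ℝ}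
    (hδ : 0 < δ) :
    P {ω | δ ≤ |(hits B (fun i => Y i ω) : ℝ) - N * ν.real B|} ≤
      ENNReal.ofReal (N * ν.real B / δ ^ 2) := by
  have hsum : (fun ω => (hits B fun i => Y i ω : ℝ)) =
      fun ω => ∑ i, (B.indicator (1 : F → ℝ) ∘ Y i) ω := by
    ext ω
    simp [cast_hits]
  have hmem : MemLp (fun ω => (hits B fun i => Y i ω : ℝ)) 2 P := by
    rw [hsum]
    exact memLp_finsetSum _ fun i _ => memLp_indicator_one_hasLaw (hY.hasLaw i) hB 2
  have hmean : ∫ ω, (hits B fun i => Y i ω : ℝ) ∂P = N * ν.real B := by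
    rw [hsum, integral_finsetSum _ fun i _ => memLp_one_iff_integrable.1
      (memLp_indicator_one_hasLaw (hY.hasLaw i) hB 1)]
    simp [integral_indicator_one_hasLaw (hY.hasLaw _) hB]
  rw [← hmean]
  refine (meas_ge_le_variance_div_sq hmem hδ).trans (ENNReal.ofReal_le_ofReal ?_)
  rw [hmean]
  gcongr
  exact variance_hits_le hY hB

end Counts

section IncrementBound

variable {α F : Type*} [SeminormedAddCommGroup F] {𝒳 : Set α} {φ ψ : α → F} {ε u δ : ℝ}
  {s t : α}

/-- The increments of `ψ - φ` over `𝒳` are at most `ε` times those of `φ`, down to scale `u`.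
This is the form in which the estimation error `ψ - φ` enters the comparison of distances. -/
def IncrementBound (𝒳 : Set α) (φ ψ : α → F) (ε u : ℝ) : Prop :=
  ∀ s ∈ 𝒳, ∀ t ∈ 𝒳, ‖(ψ s - φ s) - (ψ t - φ t)‖ ≤ ε * max u ‖φ s - φ t‖

lemma IncrementBound.norm_le (h : IncrementBound 𝒳 φ ψ ε u) (hs : s ∈ 𝒳) (ht : t ∈ 𝒳) :
    ‖ψ s - ψ t‖ ≤ ‖φ s - φ t‖ + ε * max u ‖φ s - φ t‖ := by
  have hsplit : ψ s - ψ t = (φ s - φ t) + ((ψ s - φ s) - (ψ t - φ t)) := by abel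
  rw [hsplit]
  exact (norm_add_le _ _).trans (by linarith [h s hs t ht])

lemma IncrementBound.le_norm (h : IncrementBound 𝒳 φ ψ ε u) (hs : s ∈ 𝒳) (ht : t ∈ 𝒳) :
    ‖φ s - φ t‖ - ε * max u ‖φ s - φ t‖ ≤ ‖ψ s - ψ t‖ := by
  have hsplit : φ s - φ t = (ψ s - ψ t) - ((ψ s - φ s) - (ψ t - φ t)) := by abel
  have htri := norm_sub_le (ψ s - ψ t) ((ψ s - φ s) - (ψ t - φ t))
  rw [← hsplit] at htri
  linarith [h s hs t ht]

lemma incrementBound_of_norm_sub_le (h : ∀ s ∈ 𝒳, ‖ψ s - φ s‖ ≤ δ)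
    (hδ : 2 * δ ≤ ε * u) (hε : 0 ≤ ε) : IncrementBound 𝒳 φ ψ ε u := fun s hs t ht =>
  calc ‖(ψ s - φ s) - (ψ t - φ t)‖ ≤ ‖ψ s - φ s‖ + ‖ψ t - φ t‖ := norm_sub_le _ _
    _ ≤ ε * u := by linarith [h s hs, h t ht]
    _ ≤ ε * max u ‖φ s - φ t‖ := by gcongr; exact le_max_left _ _

end IncrementBound

section Net

lemma exists_finset_isCover_closedBall {F : Type*} [PseudoMetricSpace F] [ProperSpace F] (c : F)
    (R : ℝ) {δ : ℝ≥0} (hδ : 0 < δ) :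
    ∃ S : Finset F, Metric.IsCover δ (Metric.closedBall c R) S := by
  obtain ⟨t, -, htfin, hcov⟩ := (isCompact_closedBall c R).finite_cover_balls (e := δ) hδ
  refine ⟨htfin.toFinset, Metric.isCover_iff_subset_iUnion_closedBall.2 (hcov.trans ?_)⟩
  rw [htfin.coe_toFinset]
  exact Set.iUnion₂_mono fun _ _ => Metric.ball_subset_closedBall

variable {F : Type*} [NormedAddCommGroup F] [NormedSpace ℝ F] {S : Finset F} {c w : F} {r : ℝ}

lemma exists_dist_add_smul_le {R : ℝ} {δ : ℝ≥0}
    (hS : Metric.IsCover δ (Metric.closedBall (0 : F) R) S) (hr : 0 < r) (hw : ‖w - c‖ ≤ R * r) :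
    ∃ s ∈ S, dist w (c + r • s) ≤ δ * r := by
  have hmem : r⁻¹ • (w - c) ∈ Metric.closedBall (0 : F) R := by
    rw [mem_closedBall_zero_iff, norm_smul, norm_inv, Real.norm_of_nonneg hr.le,
      inv_mul_le_iff₀ hr]
    linarith
  obtain ⟨s, hs, hys⟩ := Set.mem_iUnion₂.1
    (Metric.isCover_iff_subset_iUnion_closedBall.1 hS hmem)
  refine ⟨s, hs, ?_⟩
  have hscale : w - (c + r • s) = r • (r⁻¹ • (w - c) - s) := by
    rw [smul_sub, smul_inv_smul₀ hr.ne']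
    abel
  rw [dist_eq_norm, hscale, norm_smul, Real.norm_of_nonneg hr.le, mul_comm]
  gcongr
  rwa [Metric.mem_closedBall, dist_eq_norm] at hys

lemma exists_ball_subset_ball_of_isCover
    (hS : Metric.IsCover (1 / 8) (Metric.closedBall (0 : F) 1) S) (hr : 0 < r)
    (hw : r ≤ ‖w - c‖) :
    ∃ s ∈ S, Metric.ball (c + r • s) (1 / 4 * r) ⊆ Metric.ball w (‖w - c‖ - r / 8) := by
  -- the net point is taken near the point of the segment `[c, w]` at distance `r / 2` from `c`
  have hD : 0 < ‖w - c‖ := hr.trans_le hw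
  set a : ℝ := r / (2 * ‖w - c‖) with ha
  have haD : a * ‖w - c‖ = r / 2 := by rw [ha]; field_simp
  have ha1 : a ≤ 1 := by rw [ha, div_le_one (by positivity)]; linarith
  have hmid : ‖c + a • (w - c) - c‖ ≤ 1 * r := by
    rw [add_sub_cancel_left, norm_smul, Real.norm_of_nonneg (by positivity), haD]
    linarith
  obtain ⟨s, hs, hdist⟩ := exists_dist_add_smul_le hS hr hmid
  refine ⟨s, hs, Metric.ball_subset_ball' ?_⟩
  have hsegment : dist (c + a • (w - c)) w = ‖w - c‖ - r / 2 := by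
    rw [dist_eq_norm, show c + a • (w - c) - w = (a - 1) • (w - c) by module, norm_smul,
      Real.norm_of_nonpos (by linarith), neg_sub, sub_mul, haD, one_mul]
  have htri := dist_triangle_left (c + r • s) w (c + a • (w - c))
  push_cast at hdist
  linarith

end Net

section Catchment

variable {d m N M : ℕ} {𝒳 𝒵 : Set (E d)} {φ ψ : E d → E m} {ε u b r t : ℝ}
  {xs : Fin N → E d} {x z : E d} {S : Finset (E m)}

lemma mem_catchment_iff (hM : 1 ≤ M) (hMN : M ≤ N) :
    z ∈ catchment 𝒵 M ψ xs x ↔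
      z ∈ 𝒵 ∧ hits (Set.Iio ‖ψ x - ψ z‖) (fun i => ‖ψ (xs i) - ψ z‖) < M := by
  rw [catchment, Set.mem_ofPred_eq, matchRadius, le_orderStat_iff _ hM hMN]

lemma matchCount_eq_hits {K : ℕ} (𝒵 : Set (E d)) (M : ℕ) (ψ : E d → E m)
    (xs : Fin N → E d) (zs : Fin K → E d) (x : E d) :
    matchCount 𝒵 M ψ xs zs x = hits (catchment 𝒵 M ψ xs x) zs :=
  (cast_hits _ _).symm

lemma ratioEst_nonneg {K : ℕ} (𝒵 : Set (E d)) (M : ℕ) (ψ : E d → E m)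
    (xs : Fin N → E d) (zs : Fin K → E d) (x : E d) : 0 ≤ ratioEst 𝒵 M ψ xs zs x := by
  rw [ratioEst, matchCount_eq_hits]
  positivity

lemma IncrementBound.notMem_catchment (h : IncrementBound 𝒳 φ ψ ε u) (hε : 0 ≤ ε)
    (hM : 1 ≤ M) (hMN : M ≤ N) (hx : x ∈ 𝒳) (hz : z ∈ 𝒳) (hxs : ∀ i, xs i ∈ 𝒳)
    (hb : b + 2 * (ε * max u ‖φ x - φ z‖) ≤ ‖φ x - φ z‖)
    (hhits : M ≤ hits (Metric.ball (φ z) b) fun i => φ (xs i)) :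
    z ∉ catchment 𝒵 M ψ xs x := by
  rw [mem_catchment_iff hM hMN, not_and, not_lt]
  refine fun _ => hhits.trans (hits_le_hits fun i hi => ?_)
  rw [Metric.mem_ball, dist_eq_norm] at hi
  have hxi := h.norm_le (hxs i) hz
  have hxz := h.le_norm hx hz
  have hmax : 0 ≤ ε * max u ‖φ x - φ z‖ := mul_nonneg hε (le_max_of_le_right (norm_nonneg _))
  have hcloser : ε * max u ‖φ (xs i) - φ z‖ ≤ ε * max u ‖φ x - φ z‖ := by
    gcongr
    linarith
  rw [Set.mem_Iio]
  linarith

lemma IncrementBound.mem_catchment (h : IncrementBound 𝒳 φ ψ ε u) (hε : 0 ≤ ε) (hε1 : ε ≤ 1)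
    (hu : 0 ≤ u) (hM : 1 ≤ M) (hMN : M ≤ N) (hx : x ∈ 𝒳) (hz : z ∈ 𝒳) (hz𝒵 : z ∈ 𝒵)
    (hxs : ∀ i, xs i ∈ 𝒳) (hb : ‖φ x - φ z‖ + 2 * (ε * max u b) ≤ b)
    (hhits : hits (Metric.ball (φ z) b) (fun i => φ (xs i)) < M) :
    z ∈ catchment 𝒵 M ψ xs x := by
  rw [mem_catchment_iff hM hMN]
  refine ⟨hz𝒵, (hits_le_hits fun i hi => ?_).trans_lt hhits⟩
  rw [Metric.mem_ball, dist_eq_norm]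
  rw [Set.mem_Iio] at hi
  by_contra! hfar
  have hxi := h.le_norm (hxs i) hz
  have hxz := h.norm_le hx hz
  have hmax : 0 ≤ ε * max u b := mul_nonneg hε (le_max_of_le_left hu)
  have hcloser : ε * max u ‖φ x - φ z‖ ≤ ε * max u b := by
    gcongr
    linarith
  have hfarther : max u ‖φ (xs i) - φ z‖ ≤ max u b + (‖φ (xs i) - φ z‖ - b) :=
    max_le (by linarith [le_max_left u b]) (by linarith [le_max_right u b])
  nlinarith [mul_le_mul_of_nonneg_left hfarther hε]

/-- Every ball of radius `β * r` around a point `c + r • s`, `s ∈ S`, contains at least `M` entries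
of the sample `ys`. -/
def NetFilled {ι F : Type*} [Fintype ι] [SeminormedAddCommGroup F] [Module ℝ F] (S : Finset F)
    (c : F) (r β : ℝ) (M : ℕ) (ys : ι → F) : Prop :=
  ∀ s ∈ S, M ≤ hits (Metric.ball (c + r • s) (β * r)) ys

/-- The estimator and the sample are well behaved at the scale `2 ^ i * t`, the `i`-th of the
dyadic scales `t, 2 * t, …, 2 ^ I * t` around `φ x`. At the top scale `i = I` this includes a bound
on the estimation error itself, which rules out matches with points far away. -/
structure GoodScale (𝒳 : Set (E d)) (φ ψ : E d → E m) (ε : ℝ) (S : Finset (E m)) (M : ℕ)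
    (xs : Fin N → E d) (x : E d) (t : ℝ) (I i : ℕ) : Prop where
  incrementBound : IncrementBound 𝒳 φ ψ ε (2 ^ i * t)
  netFilled : NetFilled S (φ x) (2 ^ i * t) (1 / 4) M fun j => φ (xs j)
  norm_sub_le : i = I → ∀ s ∈ 𝒳, ‖ψ s - φ s‖ ≤ 2 ^ I * t / 32

lemma NetFilled.le_hits_ball {y : E m} {M : ℕ}
    (hS : Metric.IsCover (1 / 8) (Metric.closedBall (0 : E m) 1) S) (hr : 0 < r)
    {ys : Fin N → E m} (h : NetFilled S y r (1 / 4) M ys) {w : E m} (hw : r ≤ ‖w - y‖) :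
    M ≤ hits (Metric.ball w (‖w - y‖ - r / 8)) ys := by
  obtain ⟨s, hs, hsub⟩ := exists_ball_subset_ball_of_isCover hS hr hw
  exact (h s hs).trans (hits_le_hits fun j hj => hsub hj)

lemma norm_sub_lt_of_mem_catchment
    (hS : Metric.IsCover (1 / 8) (Metric.closedBall (0 : E m) 1) S) (ht : 0 < t) {i I : ℕ}
    (hiI : i ≤ I) (hε : 0 ≤ ε) (hε32 : ε ≤ 1 / 32)
    (hgood : ∀ k, i ≤ k → k ≤ I → GoodScale 𝒳 φ ψ ε S M xs x t I k)
    (hM : 1 ≤ M) (hMN : M ≤ N) (hx : x ∈ 𝒳) (hz : z ∈ 𝒳) (hxs : ∀ i, xs i ∈ 𝒳)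
    (hzA : z ∈ catchment 𝒵 M ψ xs x) : ‖φ z - φ x‖ < 2 ^ i * t := by
  have hfilled : ∀ k, i ≤ k → k ≤ I → 2 ^ k * t ≤ ‖φ z - φ x‖ →
      M ≤ hits (Metric.ball (φ z) (‖φ z - φ x‖ - 2 ^ k * t / 8)) fun j => φ (xs j) :=
    fun k hik hkI => (hgood k hik hkI).netFilled.le_hits_ball hS (by positivity)
  induction hiI using Nat.decreasingInduction with
  | self =>
    by_contra! hfar
    have hpos : 0 < ‖φ z - φ x‖ := lt_of_lt_of_le (by positivity) hfar
    have hεD : 2 ^ I * t / (16 * ‖φ z - φ x‖) * ‖φ z - φ x‖ = 2 ^ I * t / 16 := by field_simp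
    have hinc : IncrementBound 𝒳 φ ψ (2 ^ I * t / (16 * ‖φ z - φ x‖)) ‖φ z - φ x‖ :=
      incrementBound_of_norm_sub_le ((hgood I le_rfl le_rfl).norm_sub_le rfl) (by linarith)
        (by positivity)
    refine hinc.notMem_catchment (by positivity) hM hMN hx hz hxs ?_
      (hfilled I le_rfl le_rfl hfar) hzA
    rw [norm_sub_rev (φ x), max_self, hεD]
    linarith
  | of_succ k hk ih =>
    have hnear : ‖φ z - φ x‖ < 2 * (2 ^ k * t) := by
      have := ih (fun l hl => hgood l (by omega)) (fun l hl => hfilled l (by omega))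
      rwa [pow_succ', mul_assoc] at this
    by_contra! hfar
    refine (hgood k le_rfl hk.le).incrementBound.notMem_catchment hε hM hMN hx hz hxs ?_
      (hfilled k le_rfl hk.le hfar) hzA
    rw [norm_sub_rev (φ x), max_eq_right hfar]
    nlinarith [norm_nonneg (φ z - φ x)]

lemma norm_sub_lt_of_mem_catchment_of_netFilled {Λ : ℝ} {η : ℝ≥0} (hr : 0 < r) (hε : 0 ≤ ε)
    (hεΛ : ε * Λ ≤ η) (hS : Metric.IsCover η (Metric.closedBall (0 : E m) Λ) S)
    (hfilled : NetFilled S (φ x) r (1 + η) M fun j => φ (xs j))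
    (hinc : IncrementBound 𝒳 φ ψ ε (Λ * r))
    (hM : 1 ≤ M) (hMN : M ≤ N) (hx : x ∈ 𝒳) (hz : z ∈ 𝒳) (hxs : ∀ i, xs i ∈ 𝒳)
    (hnear : ‖φ z - φ x‖ ≤ Λ * r) (hzA : z ∈ catchment 𝒵 M ψ xs x) :
    ‖φ z - φ x‖ < (1 + 4 * η) * r := by
  by_contra! hfar
  obtain ⟨s, hs, hdist⟩ := exists_dist_add_smul_le hS hr hnear
  refine hinc.notMem_catchment (b := (1 + 2 * η) * r) hε hM hMN hx hz hxs ?_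
    ((hfilled s hs).trans (hits_le_hits fun i hi => Metric.ball_subset_ball' ?_ hi)) hzA
  · rw [norm_sub_rev (φ x), max_eq_left hnear]
    nlinarith
  · rw [dist_comm]
    linarith

lemma mem_catchment_of_hits_ball_lt {Λ : ℝ} {η : ℝ≥0} (hr : 0 < r) (hη : η ≤ 1 / 8)
    (hε : 0 ≤ ε) (hεΛ : ε * Λ ≤ η) (hΛ : 1 ≤ Λ)
    (hS : Metric.IsCover η (Metric.closedBall (0 : E m) Λ) S)
    (hcount : ∀ s ∈ S, hits (Metric.ball (φ x + r • s) ((1 - η) * r)) (fun j => φ (xs j)) < M)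
    (hinc : IncrementBound 𝒳 φ ψ ε (Λ * r))
    (hM : 1 ≤ M) (hMN : M ≤ N) (hx : x ∈ 𝒳) (hz : z ∈ 𝒳) (hz𝒵 : z ∈ 𝒵) (hxs : ∀ i, xs i ∈ 𝒳)
    (hnear : ‖φ z - φ x‖ < (1 - 4 * η) * r) : z ∈ catchment 𝒵 M ψ xs x := by
  have hη8 : (η : ℝ) ≤ 1 / 8 := by exact_mod_cast hη
  have hη0 : (0 : ℝ) ≤ η := η.coe_nonneg
  obtain ⟨s, hs, hdist⟩ := exists_dist_add_smul_le (c := φ x) (w := φ z) hS hr (by nlinarith)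
  refine hinc.mem_catchment (b := (1 - 2 * η) * r) hε (by nlinarith) (by positivity) hM hMN hx hz
    hz𝒵 hxs ?_ ((hits_le_hits fun i hi => Metric.ball_subset_ball' ?_ hi).trans_lt (hcount s hs))
  · rw [norm_sub_rev (φ x), max_eq_left (by nlinarith)]
    nlinarith
  · linarith

end Catchment

section Density

lemma tendsto_measureReal_withDensity_div {α ι : Type*} [TopologicalSpace α] [MeasurableSpace α]
    [OpensMeasurableSpace α] {μ : Measure α} [IsLocallyFiniteMeasure μ] [SFinite μ] {f : α → ℝ≥0}
    {c : α} (hf : Measurable f) (hc : ContinuousAt f c) {l : Filter ι} {B : ι → Set α}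
    (hB : Tendsto B l (𝓝 c).smallSets) (hμB : ∀ᶠ i in l, μ.real (B i) ≠ 0) :
    Tendsto (fun i => (μ.withDensity fun u => (f u : ℝ≥0∞)).real (B i) / μ.real (B i)) l
      (𝓝 (f c)) := by
  have hreal : ∀ s, (μ.withDensity fun u => (f u : ℝ≥0∞)).real s = ∫ u in s, (f u : ℝ) ∂μ := by
    intro s
    rw [measureReal_def, withDensity_apply',
      ← integral_toReal hf.coe_nnreal_ennreal.aemeasurable (by simp)]
    rfl
  have hlittle := (NNReal.continuous_coe.continuousAt.comp hc).integral_sub_linear_isLittleO_ae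
    (μ := μ) hf.coe_nnreal_real.stronglyMeasurable.stronglyMeasurableAtFilter hB
  have hlim := hlittle.tendsto_div_nhds_zero.add_const (f c : ℝ)
  rw [zero_add] at hlim
  refine hlim.congr' (hμB.mono fun i hi => ?_)
  simp only [Function.comp_apply, smul_eq_mul, hreal]
  field_simp
  ring

variable {F : Type*} [NormedAddCommGroup F] [NormedSpace ℝ F]

lemma tendsto_ball_add_smul_smallSets (c v : F) (β : ℝ) :
    Tendsto (fun h : ℝ => Metric.ball (c + h • v) (β * h)) (𝓝[>] 0) (𝓝 c).smallSets := by
  rw [Metric.nhds_basis_ball.smallSets.tendsto_right_iff]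
  intro r hr
  have hlim : Tendsto (fun h : ℝ => h * (‖v‖ + β)) (𝓝[>] 0) (𝓝 0) := by
    have := (continuous_mul_const (‖v‖ + β)).tendsto' 0 0 (zero_mul _)
    exact this.mono_left nhdsWithin_le_nhds
  filter_upwards [hlim.eventually_lt_const hr, self_mem_nhdsWithin] with h hlt hpos
  refine Metric.ball_subset_ball' ?_
  rw [dist_eq_norm, add_sub_cancel_left, norm_smul, Real.norm_of_nonneg (le_of_lt hpos)]
  linarith

variable [FiniteDimensional ℝ F] [MeasurableSpace F] {μ : Measure F} [μ.IsAddHaarMeasure]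

variable (μ) in
lemma measureReal_unit_ball_pos : 0 < μ.real (Metric.ball (0 : F) 1) :=
  ENNReal.toReal_pos (Metric.measure_ball_pos _ _ one_pos).ne' measure_ball_lt_top.ne

variable [BorelSpace F] {f : F → ℝ≥0} {c : F}

lemma addHaar_real_ball_of_pos (y : F) {ρ : ℝ} (hρ : 0 < ρ) :
    μ.real (Metric.ball y ρ) = μ.real (Metric.ball 0 1) * ρ ^ Module.finrank ℝ F := by
  rw [measureReal_def, Measure.addHaar_ball_of_pos _ _ hρ, ENNReal.toReal_mul,
    ENNReal.toReal_ofReal (by positivity), mul_comm, measureReal_def]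

lemma tendsto_withDensity_real_ball_div_pow (hf : Measurable f) (hc : ContinuousAt f c) (v : F)
    {β : ℝ} (hβ : 0 < β) :
    Tendsto (fun h : ℝ => (μ.withDensity fun u => (f u : ℝ≥0∞)).real
        (Metric.ball (c + h • v) (β * h)) / h ^ Module.finrank ℝ F) (𝓝[>] 0)
      (𝓝 (f c * (μ.real (Metric.ball (0 : F) 1) * β ^ Module.finrank ℝ F))) := by
  have hV := measureReal_unit_ball_pos μ
  have hball : ∀ᶠ h : ℝ in 𝓝[>] 0, μ.real (Metric.ball (c + h • v) (β * h)) =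
      μ.real (Metric.ball 0 1) * β ^ Module.finrank ℝ F * h ^ Module.finrank ℝ F := by
    filter_upwards [self_mem_nhdsWithin] with h hh
    rw [addHaar_real_ball_of_pos _ (mul_pos hβ hh), mul_pow, mul_assoc]
  have hne : ∀ᶠ h : ℝ in 𝓝[>] 0, μ.real (Metric.ball (c + h • v) (β * h)) ≠ 0 := by
    filter_upwards [hball, self_mem_nhdsWithin] with h hh hpos
    rw [hh]
    have : 0 < h := hpos
    positivity
  refine ((tendsto_measureReal_withDensity_div hf hc (tendsto_ball_add_smul_smallSets c v β)
    hne).mul_const _).congr' ?_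
  filter_upwards [hball, self_mem_nhdsWithin] with h hh hpos
  have : 0 < h := hpos
  rw [hh]
  field_simp

lemma eventually_le_withDensity_real_ball (hf : Measurable f) (hc : ContinuousAt f c)
    (S : Finset F) {β κ : ℝ} (hβ : 0 < β)
    (hκ : κ < f c * (μ.real (Metric.ball (0 : F) 1) * β ^ Module.finrank ℝ F)) :
    ∀ᶠ h : ℝ in 𝓝[>] 0, ∀ s ∈ S, κ * h ^ Module.finrank ℝ F ≤
      (μ.withDensity fun u => (f u : ℝ≥0∞)).real (Metric.ball (c + h • s) (β * h)) := by
  rw [eventually_all_finset]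
  intro s _
  filter_upwards [(tendsto_withDensity_real_ball_div_pow hf hc s hβ).eventually_const_lt hκ,
    self_mem_nhdsWithin] with h hlt hh
  exact ((lt_div_iff₀ (pow_pos hh _)).1 hlt).le

lemma eventually_withDensity_real_ball_le (hf : Measurable f) (hc : ContinuousAt f c) {C : ℝ}
    (hC : f c * μ.real (Metric.ball (0 : F) 1) < C) :
    ∀ᶠ h : ℝ in 𝓝[>] 0,
      (μ.withDensity fun u => (f u : ℝ≥0∞)).real (Metric.ball c h) ≤
        C * h ^ Module.finrank ℝ F := by
  have hlim := tendsto_withDensity_real_ball_div_pow (μ := μ) hf hc 0 one_pos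
  simp only [smul_zero, add_zero, one_mul, one_pow, mul_one] at hlim
  filter_upwards [hlim.eventually_lt_const hC, self_mem_nhdsWithin] with h hlt hh
  exact ((div_lt_iff₀ (pow_pos hh _)).1 hlt).le

end Density

section WeakLaw

variable {Ω F ι : Type*} [MeasurableSpace Ω] [MeasurableSpace F] {P : Measure Ω}
  [IsProbabilityMeasure P] {ν : Measure F} {Y : ℕ → Ω → F} {l : Filter ι}

lemma tendstoInMeasure_hits_div (hY : IsIIDSample Y ν P) {B : ι → Set F}
    (hB : ∀ n, MeasurableSet (B n)) {N : ι → ℕ} {a : ι → ℝ} (ha : Tendsto a l atTop) {κ : ℝ}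
    (hκ : Tendsto (fun n => N n * ν.real (B n) / a n) l (𝓝 κ)) :
    TendstoInMeasure P (fun n ω => (hits (B n) fun i : Fin (N n) => Y i ω : ℝ) / a n) l
      fun _ => κ := by
  rw [tendstoInMeasure_iff_dist]
  intro θ hθ
  have hbound : Tendsto (fun n => ENNReal.ofReal
      (N n * ν.real (B n) / a n / (θ / 2) ^ 2 / a n)) l (𝓝 0) := by
    have := ENNReal.tendsto_ofReal ((hκ.div_const ((θ / 2) ^ 2)).div_atTop ha)
    rwa [ENNReal.ofReal_zero] at this
  refine tendsto_of_tendsto_of_tendsto_of_le_of_le' tendsto_const_nhds hbound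
    (Eventually.of_forall fun _ => zero_le) ?_
  filter_upwards [ha.eventually_gt_atTop 0, Metric.tendsto_nhds.1 hκ (θ / 2) (by positivity)]
    with n han hmean
  rw [show N n * ν.real (B n) / a n / (θ / 2) ^ 2 / a n =
    N n * ν.real (B n) / (θ / 2 * a n) ^ 2 by field_simp]
  refine (measure_mono fun ω hω => ?_).trans
    (measure_abs_hits_sub_ge_le (hY.take (N n)) (hB n) (by positivity : 0 < θ / 2 * a n))
  rw [Set.mem_ofPred_eq] at hω ⊢
  have hdev := dist_triangle_right ((hits (B n) fun i : Fin (N n) => Y i ω : ℝ) / a n) κ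
    (N n * ν.real (B n) / a n)
  rw [dist_comm κ, Real.dist_eq (_ / _) (_ / _), ← sub_div, abs_div, abs_of_pos han] at hdev
  rw [← le_div_iff₀ han]
  linarith

end WeakLaw

section SupremumConditions

variable {Ω : Type*} {d m p n : ℕ} {N₁ : ℕ → ℕ} {𝒳 𝒵 : Set (E d)} {φ : E d → E m}
  {φhat : Estimator d m N₁} {X Z : ℕ → Ω → E d} {ω : Ω} {ε u v : ℝ}

lemma refitted_self (φhat : Estimator d m N₁) (X Z : ℕ → Ω → E d) (p n : ℕ) (ω : Ω) :
    refitted φhat X Z (fun k : Fin p => Z k ω) n ω = fitted φhat X Z n ω := by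
  unfold refitted fitted
  congr 1
  funext j
  by_cases h : (j : ℕ) < p <;> simp [replaceFirst, h]

lemma norm_sub_le_of_supDist_le {ψ : E d → E m} (hε : 0 ≤ ε)
    (h : supDist 𝒳 ψ φ ≤ ENNReal.ofReal ε) : ∀ s ∈ 𝒳, ‖ψ s - φ s‖ ≤ ε := fun s hs => by
  have hs' : ‖ψ s - φ s‖ₑ ≤ ENNReal.ofReal ε :=
    (le_iSup₂ (f := fun s (_ : s ∈ 𝒳) => ‖ψ s - φ s‖ₑ) s hs).trans h
  rwa [← ofReal_norm, ENNReal.ofReal_le_ofReal_iff hε] at hs'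

lemma supDist_fitted_le_supError (hZ : ∀ j, Z j ω ∈ 𝒵) :
    supDist 𝒳 (fitted φhat X Z n ω) φ ≤ supError 𝒳 𝒵 φ φhat X Z p n ω := by
  rw [← refitted_self φhat X Z p n ω]
  exact le_iSup₂ (f := fun (z : Fin p → E d) (_ : ∀ k, z k ∈ 𝒵) =>
    supDist 𝒳 (refitted φhat X Z z n ω) φ) (fun k : Fin p => Z k ω) (fun k => hZ k)

lemma incrementBound_of_relOscillation_le (hZ : ∀ j, Z j ω ∈ 𝒵) (hε : 0 ≤ ε) (hu : 0 < u)
    (h : relOscillation 𝒳 𝒵 φ φhat X Z p n u ω ≤ ENNReal.ofReal ε) :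
    IncrementBound 𝒳 φ (fitted φhat X Z n ω) ε u := by
  intro s hs t ht
  have hδ : 0 < max u ‖φ s - φ t‖ := lt_max_of_lt_left hu
  have hratio : ENNReal.ofReal (max u ‖φ s - φ t‖)⁻¹ *
      ‖(fitted φhat X Z n ω s - φ s) - (fitted φhat X Z n ω t - φ t)‖ₑ ≤ ENNReal.ofReal ε := by
    refine le_trans ?_ h
    refine le_iSup₂_of_le (max u ‖φ s - φ t‖) (le_max_left _ _) (mul_le_mul' le_rfl ?_)
    refine le_iSup₂_of_le s hs (le_iSup₂_of_le t ht (le_iSup_of_le (le_max_right _ _) ?_))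
    refine le_iSup₂_of_le (fun k : Fin p => Z k ω) (fun k => hZ k) ?_
    rw [refitted_self]
  rw [← ofReal_norm, ← ENNReal.ofReal_mul (by positivity),
    ENNReal.ofReal_le_ofReal_iff hε, inv_mul_le_iff₀ hδ] at hratio
  linarith

lemma relOscillation_anti (huv : u ≤ v) :
    relOscillation 𝒳 𝒵 φ φhat X Z p n v ω ≤ relOscillation 𝒳 𝒵 φ φhat X Z p n u ω :=
  iSup_mono fun _ => iSup_le fun h => le_iSup_of_le (huv.trans h) le_rfl

end SupremumConditions

section DyadicSums

open Classical in
lemma sum_two_pow_mul_pow_ite_le (x v : ℝ≥0∞) {a : ℕ} (ha : 1 ≤ a) (n : ℕ) :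
    ∑ i ∈ Finset.range n, (if 2 ^ i * x < v then (2 ^ i * x) ^ a else 0) ≤ 2 * v ^ a := by
  have hgeom : ∀ n, ∑ i ∈ Finset.range (n + 1), (2 ^ i * x) ^ a ≤ 2 * (2 ^ n * x) ^ a := by
    intro n
    induction n with
    | zero => simpa using le_mul_of_one_le_left zero_le one_le_two
    | succ n ih =>
      rw [Finset.sum_range_succ, two_mul]
      refine add_le_add (ih.trans ?_) le_rfl
      rw [pow_succ' 2 n, mul_assoc, mul_pow 2]
      gcongr
      exact le_self_pow₀ one_le_two (by omega)
  induction n with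
  | zero => simp
  | succ n ih =>
    by_cases h : 2 ^ n * x < v
    · calc ∑ i ∈ Finset.range (n + 1), (if 2 ^ i * x < v then (2 ^ i * x) ^ a else 0)
          ≤ ∑ i ∈ Finset.range (n + 1), (2 ^ i * x) ^ a :=
            Finset.sum_le_sum fun i _ => by split_ifs; exacts [le_rfl, zero_le]
        _ ≤ 2 * (2 ^ n * x) ^ a := hgeom n
        _ ≤ 2 * v ^ a := by gcongr
    · rw [Finset.sum_range_succ, if_neg h, add_zero]
      exact ih

lemma sum_two_pow_mul_measure_lt_le {Ω : Type*} [MeasurableSpace Ω] {P : Measure Ω}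
    {v : Ω → ℝ≥0∞} (hv : AEMeasurable v P) (x : ℝ≥0∞) {a : ℕ} (ha : 1 ≤ a) (n : ℕ) :
    ∑ i ∈ Finset.range n, (2 ^ i * x) ^ a * P {ω | 2 ^ i * x < v ω} ≤
      2 * ∫⁻ ω, v ω ^ a ∂P := by
  classical
  have hset : ∀ i : ℕ, NullMeasurableSet {ω | 2 ^ i * x < v ω} P := fun i =>
    nullMeasurableSet_lt aemeasurable_const hv
  calc ∑ i ∈ Finset.range n, (2 ^ i * x) ^ a * P {ω | 2 ^ i * x < v ω}
      = ∑ i ∈ Finset.range n,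
          ∫⁻ ω, {ω | 2 ^ i * x < v ω}.indicator (fun _ => (2 ^ i * x) ^ a) ω ∂P :=
        Finset.sum_congr rfl fun i _ => (lintegral_indicator_const₀ (hset i) _).symm
    _ = ∫⁻ ω, ∑ i ∈ Finset.range n,
          {ω | 2 ^ i * x < v ω}.indicator (fun _ => (2 ^ i * x) ^ a) ω ∂P :=
        (lintegral_finsetSum' _ fun i _ => aemeasurable_const.indicator₀ (hset i)).symm
    _ ≤ ∫⁻ ω, 2 * v ω ^ a ∂P := lintegral_mono fun ω => by
        simpa only [Set.indicator_apply, Set.mem_ofPred_eq] using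
          sum_two_pow_mul_pow_ite_le x (v ω) ha n
    _ = 2 * ∫⁻ ω, v ω ^ a ∂P := lintegral_const_mul' _ _ ENNReal.ofNat_ne_top

variable {m p : ℕ} {g : ℝ → ℝ≥0∞}

lemma pow_mul_le_setLIntegral_Ioc (hm : 1 ≤ m) (hp : 1 ≤ p) {r : ℝ} (hr : 0 < r) {κ : ℝ≥0∞}
    (hκ : ∀ u, 0 < u → u ≤ r → κ ≤ g u) :
    ENNReal.ofReal (r / 2) ^ (m * p) * κ ≤ ∫⁻ u in Set.Ioc ((r / 2) ^ m) (r ^ m),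
      ENNReal.ofReal (u ^ (p - 1)) * g (u ^ (1 / (m : ℝ))) := by
  set b := (r / 2) ^ m with hb
  have hb0 : 0 < b := by positivity
  have hlength : b ≤ r ^ m - b := by
    have : (2 : ℝ) ≤ 2 ^ m := le_self_pow₀ one_le_two (by omega)
    rw [le_sub_iff_add_le, ← two_mul, hb, div_pow, mul_div_assoc', div_le_iff₀ (by positivity),
      mul_comm]
    gcongr
  calc ENNReal.ofReal (r / 2) ^ (m * p) * κ
      = ENNReal.ofReal (b ^ (p - 1)) * κ * ENNReal.ofReal b := by
        rw [mul_right_comm, ← ENNReal.ofReal_mul (by positivity), ← pow_succ,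
          Nat.sub_add_cancel hp, hb, ← pow_mul, ENNReal.ofReal_pow (by positivity)]
    _ ≤ ENNReal.ofReal (b ^ (p - 1)) * κ * volume (Set.Ioc b (r ^ m)) := by
        rw [Real.volume_Ioc]
        gcongr
    _ = ∫⁻ _ in Set.Ioc b (r ^ m), ENNReal.ofReal (b ^ (p - 1)) * κ :=
        (setLIntegral_const _ _).symm
    _ ≤ ∫⁻ u in Set.Ioc b (r ^ m), ENNReal.ofReal (u ^ (p - 1)) * g (u ^ (1 / (m : ℝ))) := by
        refine setLIntegral_mono' measurableSet_Ioc fun u hu => ?_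
        have hu0 : 0 < u := hb0.trans hu.1
        have hroot : u ^ (1 / (m : ℝ)) ≤ r := by
          rw [one_div, Real.rpow_inv_le_iff_of_pos hu0.le hr.le (by positivity),
            Real.rpow_natCast]
          exact hu.2
        gcongr
        · exact hu.1.le
        · exact hκ _ (by positivity) hroot

lemma sum_pow_mul_le_lintegral_Ioi (hm : 1 ≤ m) (hp : 1 ≤ p) {t : ℝ} (ht : 0 < t) {κ : ℕ → ℝ≥0∞}
    (hκ : ∀ i u, 0 < u → u ≤ 2 ^ i * t → κ i ≤ g u) (I : ℕ) :
    ∑ i ∈ Finset.range I, ENNReal.ofReal (2 ^ i * t / 2) ^ (m * p) * κ i ≤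
      ∫⁻ u in Set.Ioi 0, ENNReal.ofReal (u ^ (p - 1)) * g (u ^ (1 / (m : ℝ))) := by
  set b : ℕ → ℝ := fun i => (2 ^ i * t / 2) ^ m with hb
  have hsucc : ∀ i, (2 ^ i * t) ^ m = b (i + 1) := fun i => by
    rw [hb]
    ring
  have hmono : Monotone b := monotone_nat_of_le_succ fun i => by
    rw [← hsucc]
    exact pow_le_pow_left₀ (by positivity) (by linarith [show 0 < 2 ^ i * t by positivity]) m
  calc ∑ i ∈ Finset.range I, ENNReal.ofReal (2 ^ i * t / 2) ^ (m * p) * κ i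
      ≤ ∑ i ∈ Finset.range I, ∫⁻ u in Set.Ioc (b i) (b (i + 1)),
          ENNReal.ofReal (u ^ (p - 1)) * g (u ^ (1 / (m : ℝ))) :=
        Finset.sum_le_sum fun i _ => by
          rw [← hsucc]
          exact pow_mul_le_setLIntegral_Ioc hm hp (by positivity) (hκ i)
    _ = ∫⁻ u in ⋃ i ∈ Finset.range I, Set.Ioc (b i) (b (i + 1)),
          ENNReal.ofReal (u ^ (p - 1)) * g (u ^ (1 / (m : ℝ))) :=
        (lintegral_biUnion_finset (fun i _ j _ hij => hmono.pairwise_disjoint_on_Ioc_succ hij)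
          (fun _ _ => measurableSet_Ioc) _).symm
    _ ≤ _ := by
        refine lintegral_mono_set (Set.iUnion₂_subset fun i _ u hu => lt_trans ?_ hu.1)
        positivity

end DyadicSums

section DyadicErrorCondition

variable {Ω : Type*} [MeasurableSpace Ω] {d m p q : ℕ} {N₁ M : ℕ → ℕ} {P : Measure Ω}
  {𝒳 𝒵 : Set (E d)} {φ : E d → E m} {φhat : Estimator d m N₁} {X Z : ℕ → Ω → E d}

/-- The common consequence of the two assumptions on the estimation error `ψ - φ` that the proof
uses: its relative increments are small on all dyadic scales `2 ^ i * t ≤ 1` at once, and the error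
itself is small, with failure probabilities weighted as in the `p`-th moment of the estimator. -/
structure DyadicErrorCondition (P : Measure Ω) (𝒳 : Set (E d)) (φ : E d → E m)
    (ψ : ℕ → Ω → E d → E m) (M : ℕ → ℕ) (p : ℕ) : Prop where
  increments : ∀ ε : ℝ, 0 < ε → ∃ a : ℕ → ℝ≥0∞, Tendsto a atTop (𝓝 0) ∧
    ∀ (n : ℕ) (t : ℝ) (I : ℕ), 0 < t → 2 ^ I * t ≤ 1 →
      ENNReal.ofReal (n / M n) ^ p * ∑ i ∈ Finset.range (I + 1),
        ENNReal.ofReal (2 ^ i * t) ^ (m * p) *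
          P {ω | ¬ IncrementBound 𝒳 φ (ψ n ω) ε (2 ^ i * t)} ≤ a n
  uniform : ∀ ε : ℝ, 0 < ε → Tendsto (fun n => ENNReal.ofReal (n / M n) ^ p *
    P {ω | ¬ ∀ s ∈ 𝒳, ‖ψ n ω s - φ s‖ ≤ ε}) atTop (𝓝 0)

lemma measure_not_incrementBound_le_supError (hZ : ∀ᵐ ω ∂P, ∀ j, Z j ω ∈ 𝒵) (p n : ℕ) {ε u : ℝ}
    (hε : 0 ≤ ε) (hu : 0 ≤ u) :
    P {ω | ¬ IncrementBound 𝒳 φ (fitted φhat X Z n ω) ε u} ≤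
      P {ω | ENNReal.ofReal (ε / 2 * u) < supError 𝒳 𝒵 φ φhat X Z p n ω} := by
  refine measure_mono_ae (hZ.mono fun ω hω hinc => ?_)
  by_contra hsmall
  exact hinc (incrementBound_of_norm_sub_le (norm_sub_le_of_supDist_le (by positivity)
    ((supDist_fitted_le_supError hω).trans (not_lt.1 hsmall))) (by linarith) hε)

lemma sum_measure_not_incrementBound_le (hp : 1 ≤ p) (hq : 1 ≤ q) (hqm : q ≤ m)
    (hZ : ∀ᵐ ω ∂P, ∀ j, Z j ω ∈ 𝒵) {n : ℕ}
    (hmeas : AEMeasurable (supError 𝒳 𝒵 φ φhat X Z p n) P) {ε t : ℝ} (hε : 0 < ε)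
    (ht : 0 < t) {I : ℕ} (hI : 2 ^ I * t ≤ 1) :
    ∑ i ∈ Finset.range (I + 1), ENNReal.ofReal (2 ^ i * t) ^ (m * p) *
        P {ω | ¬ IncrementBound 𝒳 φ (fitted φhat X Z n ω) ε (2 ^ i * t)} ≤
      ENNReal.ofReal (2 / ε) ^ (p * q) * (2 * ∫⁻ ω,
        supError 𝒳 𝒵 φ φhat X Z p n ω ^ (p * q) ∂P) := by
  set x : ℝ≥0∞ := ENNReal.ofReal (ε / 2 * t) with hx
  refine le_trans ?_ (mul_le_mul' le_rfl
    (sum_two_pow_mul_measure_lt_le hmeas x (Nat.mul_pos hp hq) (I + 1)))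
  rw [Finset.mul_sum]
  refine Finset.sum_le_sum fun i hi => ?_
  have hscale : ENNReal.ofReal (ε / 2 * (2 ^ i * t)) = 2 ^ i * x := by
    rw [hx, mul_left_comm, ENNReal.ofReal_mul (by positivity), ENNReal.ofReal_pow (by norm_num),
      ENNReal.ofReal_ofNat]
  have hle1 : 2 ^ i * t ≤ 1 := by
    refine le_trans ?_ hI
    gcongr
    · exact one_le_two
    · exact Nat.lt_succ_iff.1 (Finset.mem_range.1 hi)
  rw [← mul_assoc, ← hscale, ← mul_pow, ← ENNReal.ofReal_mul (by positivity),
    show 2 / ε * (ε / 2 * (2 ^ i * t)) = 2 ^ i * t by field_simp]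
  refine mul_le_mul' (pow_le_pow_right_of_le_one' (ENNReal.ofReal_le_one.2 hle1) ?_)
    (measure_not_incrementBound_le_supError hZ p n hε.le (by positivity))
  rw [mul_comm m]
  exact Nat.mul_le_mul_left p hqm

lemma UniformErrorCondition.dyadicErrorCondition (hp : 1 ≤ p) (hq : 1 ≤ q) (hqm : q ≤ m)
    (hZ : ∀ᵐ ω ∂P, ∀ j, Z j ω ∈ 𝒵) (h : UniformErrorCondition P 𝒳 𝒵 φ φhat X Z M p q) :
    DyadicErrorCondition P 𝒳 φ (fitted φhat X Z) M p := by
  obtain ⟨hmeas, hlim⟩ := h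
  simp_rw [lintegral_const_mul' _ _ (ENNReal.pow_ne_top ENNReal.ofReal_ne_top)] at hlim
  have hscaled : ∀ c : ℝ≥0∞, c ≠ ∞ → Tendsto (fun n => c * (ENNReal.ofReal (n / M n) ^ p *
      ∫⁻ ω, supError 𝒳 𝒵 φ φhat X Z p n ω ^ (p * q) ∂P)) atTop (𝓝 0) := by
    intro c hc
    simpa using ENNReal.Tendsto.const_mul hlim (Or.inr hc)
  constructor
  · intro ε hε
    refine ⟨_, hscaled (ENNReal.ofReal (2 / ε) ^ (p * q) * 2) (ENNReal.mul_ne_top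
      (ENNReal.pow_ne_top ENNReal.ofReal_ne_top) ENNReal.ofNat_ne_top), fun n t I ht hI => ?_⟩
    rw [mul_left_comm, mul_assoc]
    gcongr
    exact sum_measure_not_incrementBound_le hp hq hqm hZ (hmeas n) hε ht hI
  · intro ε hε
    refine tendsto_of_tendsto_of_tendsto_of_le_of_le tendsto_const_nhds
      (hscaled (ENNReal.ofReal ε ^ (p * q))⁻¹ (by simp [hε])) (fun _ => zero_le) fun n => ?_
    have hsub : P {ω | ¬ ∀ s ∈ 𝒳, ‖fitted φhat X Z n ω s - φ s‖ ≤ ε} ≤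
        P {ω | ENNReal.ofReal ε ^ (p * q) ≤
          supError 𝒳 𝒵 φ φhat X Z p n ω ^ (p * q)} := by
      refine measure_mono_ae (hZ.mono fun ω hω hlarge => ?_)
      by_contra hsmall
      exact hlarge (norm_sub_le_of_supDist_le hε.le ((supDist_fitted_le_supError hω).trans
        (lt_of_pow_lt_pow_left' _ (not_le.1 hsmall)).le))
    rw [mul_left_comm]
    gcongr
    refine hsub.trans ((meas_ge_le_lintegral_div ((hmeas n).pow_const _) (by simp [hε])
      (ENNReal.pow_ne_top ENNReal.ofReal_ne_top)).trans_eq ?_)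
    rw [ENNReal.div_eq_inv_mul]

lemma OscillationCondition.dyadicErrorCondition (hm : 1 ≤ m) (hp : 1 ≤ p)
    (hZ : ∀ᵐ ω ∂P, ∀ j, Z j ω ∈ 𝒵) (h : OscillationCondition P 𝒳 𝒵 φ φhat X Z M p) :
    DyadicErrorCondition P 𝒳 φ (fitted φhat X Z) M p := by
  constructor
  · intro ε hε
    obtain ⟨⟨T, hT, hTlim⟩, -⟩ := h ε hε
    have htwo : (2 : ℝ≥0∞) ^ (m * p) ≠ ∞ := ENNReal.pow_ne_top ENNReal.ofNat_ne_top
    have hhalf : ∀ r : ℝ, 2 * ENNReal.ofReal (r / 2) = ENNReal.ofReal r := fun r => by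
      rw [← ENNReal.ofReal_ofNat, ← ENNReal.ofReal_mul zero_le_two,
        mul_div_cancel₀ _ two_ne_zero]
    have hlim := ENNReal.Tendsto.const_mul (hTlim p (Finset.mem_Icc.2 ⟨hp, le_rfl⟩))
      (Or.inr htwo)
    rw [mul_zero] at hlim
    refine ⟨_, hlim, fun n t I ht _ => ?_⟩
    rw [mul_left_comm]
    gcongr
    refine le_trans ?_ (mul_le_mul' le_rfl (sum_pow_mul_le_lintegral_Ioi hm hp ht
      (κ := fun i => P {ω | ¬ IncrementBound 𝒳 φ (fitted φhat X Z n ω) ε (2 ^ i * t)})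
      (fun i u hu hui => (measure_mono_ae (hZ.mono fun ω hω hinc => ?_)).trans (hT n u hu))
      (I + 1)))
    · rw [Finset.mul_sum]
      refine Finset.sum_le_sum fun i _ => le_of_eq ?_
      rw [← mul_assoc, ← mul_pow, hhalf]
    · by_contra hsmall
      exact hinc (incrementBound_of_relOscillation_le hω hε.le (by positivity)
        ((relOscillation_anti hui).trans (not_lt.1 hsmall)))
  · intro ε hε
    refine tendsto_of_tendsto_of_tendsto_of_le_of_le tendsto_const_nhds (h ε hε).2
      (fun _ => zero_le) fun n => ?_
    dsimp only
    gcongr with ω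
    intro hlarge
    by_contra hsmall
    exact hlarge (norm_sub_le_of_supDist_le hε.le (not_lt.1 hsmall))

end DyadicErrorCondition

section Scales

variable {m : ℕ} {M N₁ : ℕ → ℕ} {G : ℝ} {n : ℕ}

/-- The growth conditions on the number `M` of matches and the sample size `N₁`, as functions of
the sample size `N₀ = n`. -/
structure MatchingRates (N₁ M : ℕ → ℕ) : Prop where
  tendsto_div : Tendsto (fun n => (M n : ℝ) / n) atTop (𝓝 0)
  tendsto_mul_div : Tendsto (fun n => (M n : ℝ) * N₁ n / n) atTop atTop
  tendsto_matches : Tendsto M atTop atTop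

/-- The radius `h` with `n * h ^ m = G * M`. If `1 / G` is the density times the volume of the unit
ball, then a ball of radius `h` is expected to contain `M` out of `n` observations. -/
def matchScale (m : ℕ) (M : ℕ → ℕ) (G : ℝ) (n : ℕ) : ℝ := (G * (M n / n)) ^ (1 / (m : ℝ))

/-- The index `I` of the largest dyadic multiple `2 ^ I * t` of `t` that is at most `u`. -/
def topScale (u t : ℝ) : ℕ := Nat.log 2 ⌊u / t⌋₊

lemma two_pow_topScale_mul_le {u t : ℝ} (ht : 0 < t) (htu : t ≤ u) :
    2 ^ topScale u t * t ≤ u := by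
  have hfloor : ⌊u / t⌋₊ ≠ 0 := (Nat.floor_pos.2 ((one_le_div ht).2 htu)).ne'
  rw [← le_div_iff₀ ht]
  exact_mod_cast (Nat.cast_le.2 (Nat.pow_log_le_self 2 hfloor)).trans
    (Nat.floor_le (div_nonneg (ht.le.trans htu) ht.le))

lemma lt_two_pow_topScale_succ_mul (u : ℝ) {t : ℝ} (ht : 0 < t) :
    u < 2 ^ (topScale u t + 1) * t := by
  rw [← div_lt_iff₀ ht]
  have hlog : ⌊u / t⌋₊ < 2 ^ (topScale u t + 1) := Nat.lt_pow_succ_log_self one_lt_two _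
  exact_mod_cast (Nat.lt_floor_add_one _).trans_le (by exact_mod_cast hlog)

lemma matchScale_pow (hm : 1 ≤ m) (hG : 0 ≤ G) (M : ℕ → ℕ) (n : ℕ) :
    matchScale m M G n ^ m = G * (M n / n) := by
  rw [matchScale, one_div, Real.rpow_inv_natCast_pow (by positivity) (by omega)]

lemma mul_matchScale (hm : 1 ≤ m) {c : ℝ} (hc : 0 ≤ c) (hG : 0 ≤ G) (M : ℕ → ℕ) (n : ℕ) :
    matchScale m M (c ^ m * G) n = c * matchScale m M G n := by
  rw [matchScale, mul_assoc, Real.mul_rpow (by positivity) (by positivity), one_div,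
    Real.pow_rpow_inv_natCast hc (by omega), matchScale, one_div]

lemma ofReal_div_pow_mul_ofReal_matchScale_pow (hm : 1 ≤ m) (hG : 0 ≤ G) (hn : n ≠ 0)
    (hM : M n ≠ 0) (p i : ℕ) :
    ENNReal.ofReal (n / M n) ^ p * ENNReal.ofReal (2 ^ i * matchScale m M G n) ^ (m * p) =
      ENNReal.ofReal G ^ p * 2 ^ (i * m * p) := by
  have hscale : (n : ℝ) / M n * (2 ^ i * matchScale m M G n) ^ m = G * 2 ^ (i * m) := by
    rw [mul_pow, matchScale_pow hm hG, ← pow_mul]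
    field_simp
  have hnonneg : 0 ≤ matchScale m M G n := by
    unfold matchScale
    positivity
  rw [pow_mul, ← mul_pow, ← ENNReal.ofReal_pow (by positivity),
    ← ENNReal.ofReal_mul (by positivity), hscale, ENNReal.ofReal_mul hG, mul_pow,
    ENNReal.ofReal_pow zero_le_two, ENNReal.ofReal_ofNat, ← pow_mul]

namespace MatchingRates

lemma eventually_le (h : MatchingRates N₁ M) : ∀ᶠ n in atTop, 1 ≤ M n ∧ M n ≤ n := by
  filter_upwards [h.tendsto_matches.eventually_ge_atTop 1, eventually_gt_atTop 0,
    h.tendsto_div.eventually_lt_const one_pos] with n hM hn hlt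
  have : (0 : ℝ) < n := by exact_mod_cast hn
  rw [div_lt_one this] at hlt
  exact ⟨hM, by exact_mod_cast hlt.le⟩

lemma eventually_pos (h : MatchingRates N₁ M) : ∀ᶠ n in atTop, 0 < N₁ n := by
  filter_upwards [h.tendsto_mul_div.eventually_gt_atTop 0] with n hn
  exact Nat.pos_of_ne_zero fun h0 => by simp [h0] at hn

lemma tendsto_matchScale (h : MatchingRates N₁ M) (hm : 1 ≤ m) (hG : 0 < G) :
    Tendsto (matchScale m M G) atTop (𝓝[>] 0) := by
  have hm' : (0 : ℝ) < 1 / (m : ℝ) := by positivity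
  refine tendsto_nhdsWithin_iff.2 ⟨?_, ?_⟩
  · have := (h.tendsto_div.const_mul G).rpow_const (p := 1 / (m : ℝ)) (Or.inr hm'.le)
    rwa [mul_zero, Real.zero_rpow hm'.ne'] at this
  · filter_upwards [h.eventually_le] with n hn
    have hM : 0 < M n := hn.1
    have hn' : 0 < n := hM.trans_le hn.2
    exact Real.rpow_pos_of_pos (by positivity) _

end MatchingRates

lemma tendsto_div_of_tendsto_mul_log_div
    (h : Tendsto (fun n : ℕ => (M n : ℝ) * Real.log n / n) atTop (𝓝 0)) :
    Tendsto (fun n : ℕ => (M n : ℝ) / n) atTop (𝓝 0) := by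
  have hlog : ∀ᶠ n : ℕ in atTop, 1 ≤ Real.log n :=
    (Real.tendsto_log_atTop.comp tendsto_natCast_atTop_atTop).eventually_ge_atTop 1
  refine squeeze_zero' (Eventually.of_forall fun n => by positivity) ?_ h
  filter_upwards [hlog] with n hn
  gcongr
  exact le_mul_of_one_le_right (Nat.cast_nonneg _) hn

end Scales

section ExponentialSums

variable {a : ℝ}

lemma pow_mul_exp_neg_le (ha : 0 < a) (p : ℕ) :
    a ^ p * Real.exp (-a) ≤ (p + 1).factorial / a := by
  have hexp := Real.pow_div_factorial_le_exp _ ha.le (p + 1)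
  rw [div_le_iff₀ (by positivity)] at hexp
  rw [Real.exp_neg, ← div_eq_mul_inv, div_le_div_iff₀ (Real.exp_pos _) ha, ← pow_succ]
  linarith

lemma sum_pow_mul_exp_neg_le (ha : 0 < a) {m : ℕ} (hm : 1 ≤ m) (p I : ℕ) :
    ∑ i ∈ Finset.range I, (a * 2 ^ (i * m)) ^ p * Real.exp (-(a * 2 ^ (i * m))) ≤
      2 * (p + 1).factorial / a := by
  have hpow : ∀ i, (2 : ℝ) ^ i ≤ 2 ^ (i * m) := fun i =>
    pow_le_pow_right₀ one_le_two (Nat.le_mul_of_pos_right i hm)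
  calc ∑ i ∈ Finset.range I, (a * 2 ^ (i * m)) ^ p * Real.exp (-(a * 2 ^ (i * m)))
      ≤ ∑ i ∈ Finset.range I, (p + 1).factorial / a * (1 / (2 : ℝ)) ^ i := by
        refine Finset.sum_le_sum fun i _ => (pow_mul_exp_neg_le (by positivity) p).trans ?_
        rw [one_div, inv_pow, ← div_eq_mul_inv, div_div]
        have := hpow i
        gcongr
    _ ≤ (p + 1).factorial / a * 2 := by
        rw [← Finset.mul_sum]
        gcongr
        exact sum_geometric_two_le I
    _ = 2 * (p + 1).factorial / a := by ring

end ExponentialSums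

section FailureProbability

variable {Ω : Type*} [MeasurableSpace Ω] {d m p : ℕ} {N₁ M : ℕ → ℕ} {P : Measure Ω}
  {𝒳 : Set (E d)} {φ : E d → E m} {ψ : ℕ → Ω → E d → E m} {G u ε : ℝ}

lemma tendsto_sum_measure_not_incrementBound (hψ : DyadicErrorCondition P 𝒳 φ ψ M p)
    (hrates : MatchingRates N₁ M) (hm : 1 ≤ m) (hG : 0 < G) (hu : 0 < u) (hu1 : u ≤ 1)
    (hε : 0 < ε) :
    Tendsto (fun n => ∑ i ∈ Finset.range (topScale u (matchScale m M G n) + 1),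
      2 ^ (i * m * p) * P {ω | ¬ IncrementBound 𝒳 φ (ψ n ω) ε (2 ^ i * matchScale m M G n)})
      atTop (𝓝 0) := by
  obtain ⟨a, ha, hbound⟩ := hψ.increments ε hε
  have hGp : ENNReal.ofReal G ^ p ≠ 0 := by simp [hG]
  have hGp' : ENNReal.ofReal G ^ p ≠ ∞ := ENNReal.pow_ne_top ENNReal.ofReal_ne_top
  have hlim : Tendsto (fun n => (ENNReal.ofReal G ^ p)⁻¹ * a n) atTop (𝓝 0) := by
    simpa using ENNReal.Tendsto.const_mul ha (Or.inr (ENNReal.inv_ne_top.2 hGp))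
  refine tendsto_of_tendsto_of_tendsto_of_le_of_le' tendsto_const_nhds hlim
    (Eventually.of_forall fun _ => zero_le) ?_
  filter_upwards [hrates.eventually_le,
    hrates.tendsto_matchScale hm hG (Ioc_mem_nhdsGT hu)] with n hn ht
  rw [mul_comm, ← div_eq_mul_inv, ENNReal.le_div_iff_mul_le (Or.inl hGp) (Or.inl hGp'), mul_comm]
  refine le_of_eq_of_le ?_ (hbound n _ _ ht.1 ((two_pow_topScale_mul_le ht.1 ht.2).trans hu1))
  rw [Finset.mul_sum, Finset.mul_sum]
  refine Finset.sum_congr rfl fun i _ => ?_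
  rw [← mul_assoc, ← mul_assoc,
    ofReal_div_pow_mul_ofReal_matchScale_pow hm hG.le (by omega) (by omega)]

lemma tendsto_two_pow_topScale_mul_measure_sup (hψ : DyadicErrorCondition P 𝒳 φ ψ M p)
    (hrates : MatchingRates N₁ M) (hm : 1 ≤ m) (hG : 0 < G) (hu : 0 < u) (hu1 : u ≤ 1)
    (hε : 0 < ε) :
    Tendsto (fun n => 2 ^ (topScale u (matchScale m M G n) * m * p) *
      P {ω | ¬ ∀ s ∈ 𝒳, ‖ψ n ω s - φ s‖ ≤
        ε * (2 ^ topScale u (matchScale m M G n) * matchScale m M G n)}) atTop (𝓝 0) := by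
  have hGp : ENNReal.ofReal G ^ p ≠ 0 := by simp [hG]
  have hGp' : ENNReal.ofReal G ^ p ≠ ∞ := ENNReal.pow_ne_top ENNReal.ofReal_ne_top
  have hlim : Tendsto (fun n => (ENNReal.ofReal G ^ p)⁻¹ * (ENNReal.ofReal (n / M n) ^ p *
      P {ω | ¬ ∀ s ∈ 𝒳, ‖ψ n ω s - φ s‖ ≤ ε * (u / 2)})) atTop (𝓝 0) := by
    simpa using ENNReal.Tendsto.const_mul (hψ.uniform (ε * (u / 2)) (by positivity))
      (Or.inr (ENNReal.inv_ne_top.2 hGp))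
  refine tendsto_of_tendsto_of_tendsto_of_le_of_le' tendsto_const_nhds hlim
    (Eventually.of_forall fun _ => zero_le) ?_
  filter_upwards [hrates.eventually_le,
    hrates.tendsto_matchScale hm hG (Ioc_mem_nhdsGT hu)] with n hn ht
  set t := matchScale m M G n
  have htop : ENNReal.ofReal (2 ^ topScale u t * t) ≤ 1 :=
    ENNReal.ofReal_le_one.2 ((two_pow_topScale_mul_le ht.1 ht.2).trans hu1)
  have hhalf : u / 2 ≤ 2 ^ topScale u t * t := by
    have := lt_two_pow_topScale_succ_mul u ht.1
    rw [pow_succ] at this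
    linarith
  have hweight : 2 ^ (topScale u t * m * p) ≤
      (ENNReal.ofReal G ^ p)⁻¹ * ENNReal.ofReal (n / M n) ^ p := by
    rw [mul_comm _ (_ ^ p), ← div_eq_mul_inv, ENNReal.le_div_iff_mul_le (Or.inl hGp) (Or.inl hGp'),
      mul_comm, ← ofReal_div_pow_mul_ofReal_matchScale_pow (M := M) (n := n) hm hG.le (by omega)
        (by omega)]
    exact mul_le_of_le_one_right' (pow_le_one₀ zero_le htop)
  refine (mul_le_mul' hweight (measure_mono fun ω => ?_)).trans_eq (mul_assoc _ _ _)
  exact mt fun h s hs => (h s hs).trans (by gcongr)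

variable [IsProbabilityMeasure P] {F : Type*} [NormedAddCommGroup F] [NormedSpace ℝ F]
  [MeasurableSpace F] [BorelSpace F] {Y : ℕ → Ω → F} {ν : Measure F} {S : Finset F} {c : F}

lemma measure_not_netFilled_le {n k : ℕ} (hY : IsIIDSample Y ν P) {r β a : ℝ}
    (hmass : ∀ s ∈ S, a ≤ n * ν.real (Metric.ball (c + r • s) (β * r)) / 2) :
    P {ω | ¬ NetFilled S c r β k fun j : Fin n => Y j ω} ≤
      S.card * ENNReal.ofReal (Real.exp (k - a)) := by
  have hsub : {ω | ¬ NetFilled S c r β k fun j : Fin n => Y j ω} ⊆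
      ⋃ s ∈ S, {ω | hits (Metric.ball (c + r • s) (β * r)) (fun j : Fin n => Y j ω) < k} := by
    intro ω hω
    simpa [NetFilled] using hω
  refine (measure_mono hsub).trans ((measure_biUnion_finset_le _ _).trans ?_)
  rw [← nsmul_eq_mul]
  refine Finset.sum_le_card_nsmul _ _ _ fun s hs =>
    (measure_hits_lt_le (hY.take n) measurableSet_ball k).trans ?_
  gcongr
  exact hmass s hs

lemma measure_not_netFilled_matchScale_le (hY : IsIIDSample Y ν P) (hm : 1 ≤ m) (hG : 0 < G)
    {n : ℕ} (hn : n ≠ 0) (hM : 1 ≤ M n) (i : ℕ)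
    (hmass : ∀ s ∈ S, 4 / G * (2 ^ i * matchScale m M G n) ^ m ≤
      ν.real (Metric.ball (c + (2 ^ i * matchScale m M G n) • s)
        (1 / 4 * (2 ^ i * matchScale m M G n)))) :
    P {ω | ¬ NetFilled S c (2 ^ i * matchScale m M G n) (1 / 4) (M n) fun j : Fin n => Y j ω} ≤
      S.card * ENNReal.ofReal (Real.exp (-(M n * 2 ^ (i * m)))) := by
  have hcount : n * (4 / G * (2 ^ i * matchScale m M G n) ^ m) / 2 = 2 * (M n * 2 ^ (i * m)) := by
    rw [mul_pow, matchScale_pow hm hG.le, ← pow_mul]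
    field_simp
    norm_num
  refine (measure_not_netFilled_le hY (a := 2 * (M n * 2 ^ (i * m))) fun s hs => ?_).trans ?_
  · rw [← hcount]
    have := hmass s hs
    gcongr
  · gcongr
    have : (M n : ℝ) * 1 ≤ M n * 2 ^ (i * m) := by gcongr; exact one_le_pow₀ one_le_two
    linarith

lemma sum_two_pow_mul_ofReal_exp_le {k : ℕ} (hk : 1 ≤ k) (hm : 1 ≤ m) (p I : ℕ) :
    ∑ i ∈ Finset.range I, 2 ^ (i * m * p) * ENNReal.ofReal (Real.exp (-(k * 2 ^ (i * m)))) ≤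
      ENNReal.ofReal (2 * (p + 1).factorial / k) := by
  have hk1 : (1 : ℝ) ≤ k := by exact_mod_cast hk
  refine le_trans ?_ (ENNReal.ofReal_le_ofReal
    (sum_pow_mul_exp_neg_le (one_pos.trans_le hk1) hm p I))
  rw [ENNReal.ofReal_sum_of_nonneg fun i _ => by positivity]
  refine Finset.sum_le_sum fun i _ => ?_
  rw [ENNReal.ofReal_mul (by positivity), pow_mul, ENNReal.ofReal_pow (by positivity)]
  gcongr
  rw [← ENNReal.ofReal_ofNat, ← ENNReal.ofReal_pow zero_le_two]
  exact ENNReal.ofReal_le_ofReal (le_mul_of_one_le_left (by positivity) hk1)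

lemma tendsto_sum_measure_not_netFilled (hY : IsIIDSample Y ν P) (hrates : MatchingRates N₁ M)
    (hm : 1 ≤ m) (hG : 0 < G) (hu : 0 < u) (p : ℕ)
    (hmass : ∀ t ∈ Set.Ioc 0 u, ∀ s ∈ S,
      4 / G * t ^ m ≤ ν.real (Metric.ball (c + t • s) (1 / 4 * t))) :
    Tendsto (fun n => ∑ i ∈ Finset.range (topScale u (matchScale m M G n) + 1),
      2 ^ (i * m * p) * P {ω | ¬ NetFilled S c (2 ^ i * matchScale m M G n) (1 / 4) (M n)
        fun j : Fin n => Y j ω}) atTop (𝓝 0) := by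
  have hlim : Tendsto (fun n => S.card * ENNReal.ofReal (2 * (p + 1).factorial / M n)) atTop
      (𝓝 0) := by
    have := ENNReal.tendsto_ofReal
      ((tendsto_const_nhds (x := (2 * (p + 1).factorial : ℝ))).div_atTop
        (tendsto_natCast_atTop_atTop.comp hrates.tendsto_matches))
    simpa using ENNReal.Tendsto.const_mul this (Or.inr (ENNReal.natCast_ne_top S.card))
  refine tendsto_of_tendsto_of_tendsto_of_le_of_le' tendsto_const_nhds hlim
    (Eventually.of_forall fun _ => zero_le) ?_
  filter_upwards [hrates.eventually_le,
    hrates.tendsto_matchScale hm hG (Ioc_mem_nhdsGT hu)] with n hn ht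
  refine le_trans ?_ (mul_le_mul' le_rfl (sum_two_pow_mul_ofReal_exp_le hn.1 hm p
    (topScale u (matchScale m M G n) + 1)))
  rw [Finset.mul_sum]
  refine Finset.sum_le_sum fun i hi => ?_
  have hit : 2 ^ i * matchScale m M G n ∈ Set.Ioc 0 u := by
    have ht0 := ht.1
    refine ⟨by positivity, le_trans ?_ (two_pow_topScale_mul_le ht.1 ht.2)⟩
    gcongr
    · exact one_le_two
    · exact Nat.lt_succ_iff.1 (Finset.mem_range.1 hi)
  rw [mul_left_comm]
  gcongr
  exact measure_not_netFilled_matchScale_le hY hm hG (by omega) hn.1 i (hmass _ hit)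

end FailureProbability

section GoodScales

variable {Ω : Type*} [MeasurableSpace Ω] {d m p : ℕ} {N₁ M : ℕ → ℕ} {P : Measure Ω}
  {𝒳 : Set (E d)} {φ : E d → E m} {ψ : ℕ → Ω → E d → E m}
  {X : ℕ → Ω → E d} {ν : Measure (E m)} {S : Finset (E m)} {x : E d} {G u ε : ℝ}

lemma measure_not_goodScale_le (n : ℕ) (t : ℝ) (I i : ℕ) :
    P {ω | ¬ GoodScale 𝒳 φ (ψ n ω) ε S (M n) (fun j : Fin n => X j ω) x t I i} ≤
      P {ω | ¬ IncrementBound 𝒳 φ (ψ n ω) ε (2 ^ i * t)} +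
      P {ω | ¬ NetFilled S (φ x) (2 ^ i * t) (1 / 4) (M n) fun j : Fin n => φ (X j ω)} +
      if i = I then P {ω | ¬ ∀ s ∈ 𝒳, ‖ψ n ω s - φ s‖ ≤ 1 / 32 * (2 ^ I * t)} else 0 := by
  have hsup : P {ω | ¬ (i = I → ∀ s ∈ 𝒳, ‖ψ n ω s - φ s‖ ≤ 1 / 32 * (2 ^ I * t))} =
      if i = I then P {ω | ¬ ∀ s ∈ 𝒳, ‖ψ n ω s - φ s‖ ≤ 1 / 32 * (2 ^ I * t)} else 0 := by
    split_ifs with h <;> simp [h]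
  rw [← hsup]
  refine (measure_mono fun ω hω => ?_).trans ((measure_union_le _ _).trans
    (add_le_add (measure_union_le _ _) le_rfl))
  by_contra hgood
  simp only [Set.mem_union, Set.mem_ofPred_eq, not_or, not_not] at hgood
  exact hω ⟨hgood.1.1, hgood.1.2, fun hi s hs => (hgood.2 hi s hs).trans_eq (by ring)⟩

variable [IsProbabilityMeasure P]

lemma tendsto_sum_measure_not_goodScale (hX : IsIIDSample (fun i => φ ∘ X i) ν P)
    (hrates : MatchingRates N₁ M) (hψ : DyadicErrorCondition P 𝒳 φ ψ M p) (hm : 1 ≤ m)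
    (hG : 0 < G) (hu : 0 < u) (hu1 : u ≤ 1) (hε : 0 < ε)
    (hmass : ∀ t ∈ Set.Ioc 0 u, ∀ s ∈ S,
      4 / G * t ^ m ≤ ν.real (Metric.ball (φ x + t • s) (1 / 4 * t))) :
    Tendsto (fun n => ∑ i ∈ Finset.range (topScale u (matchScale m M G n) + 1),
      2 ^ (i * m * p) * P {ω | ¬ GoodScale 𝒳 φ (ψ n ω) ε S (M n) (fun j : Fin n => X j ω) x
        (matchScale m M G n) (topScale u (matchScale m M G n)) i}) atTop (𝓝 0) := by
  have hlim := ((tendsto_sum_measure_not_incrementBound hψ hrates hm hG hu hu1 hε).add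
    (tendsto_sum_measure_not_netFilled hX hrates hm hG hu p hmass)).add
    (tendsto_two_pow_topScale_mul_measure_sup hψ hrates hm hG hu hu1
      (by norm_num : (0 : ℝ) < 1 / 32))
  rw [add_zero, add_zero] at hlim
  refine tendsto_of_tendsto_of_tendsto_of_le_of_le tendsto_const_nhds hlim
    (fun _ => zero_le) fun n => ?_
  refine (Finset.sum_le_sum fun i _ => mul_le_mul' le_rfl
    (measure_not_goodScale_le n _ _ i)).trans_eq ?_
  simp only [mul_add, Finset.sum_add_distrib, mul_ite, mul_zero, Finset.sum_ite_eq',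
    Finset.self_mem_range_succ, if_true]
  rfl

lemma tendsto_measure_not_forall_goodScale (hX : IsIIDSample (fun i => φ ∘ X i) ν P)
    (hrates : MatchingRates N₁ M) (hψ : DyadicErrorCondition P 𝒳 φ ψ M p) (hm : 1 ≤ m)
    (hG : 0 < G) (hu : 0 < u) (hu1 : u ≤ 1) (hε : 0 < ε)
    (hmass : ∀ t ∈ Set.Ioc 0 u, ∀ s ∈ S,
      4 / G * t ^ m ≤ ν.real (Metric.ball (φ x + t • s) (1 / 4 * t))) :
    Tendsto (fun n => P {ω | ¬ ∀ i ≤ topScale u (matchScale m M G n),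
      GoodScale 𝒳 φ (ψ n ω) ε S (M n) (fun j : Fin n => X j ω) x
        (matchScale m M G n) (topScale u (matchScale m M G n)) i}) atTop (𝓝 0) := by
  refine tendsto_of_tendsto_of_tendsto_of_le_of_le tendsto_const_nhds
    (tendsto_sum_measure_not_goodScale hX hrates hψ hm hG hu hu1 hε hmass) (fun _ => zero_le)
    fun n => (measure_mono fun ω hω => ?_).trans ((measure_biUnion_finset_le _ _).trans
      (Finset.sum_le_sum fun i _ => le_mul_of_one_le_left zero_le (one_le_pow₀ one_le_two)))
  simpa [Nat.lt_succ_iff] using hω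

end GoodScales

section Domination

lemma pow_le_two_pow_mul_add_tsub_pow {a b : ℝ≥0∞} (h : a ≤ b) (c : ℝ≥0∞) (p : ℕ) :
    a ^ p ≤ 2 ^ p * (c ^ p + (b - c) ^ p) := by
  have hmax : a ≤ 2 * max c (b - c) :=
    (h.trans le_add_tsub).trans (by
      rw [two_mul]
      exact add_le_add (le_max_left _ _) (le_max_right _ _))
  calc a ^ p ≤ (2 * max c (b - c)) ^ p := by gcongr
    _ = 2 ^ p * max c (b - c) ^ p := mul_pow _ _ _
    _ ≤ 2 ^ p * (c ^ p + (b - c) ^ p) := by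
        gcongr
        rcases max_choice c (b - c) with h | h <;> rw [h]
        exacts [le_self_add, le_add_self]

open Classical in
lemma pow_le_of_forall_le_of_last_failure {κ : ℝ≥0∞} {cnt l : ℕ → ℝ≥0∞} {bad : ℕ → Prop} {n : ℕ}
    (hκ : ∀ i ≤ n, (∀ k, i ≤ k → k < n → ¬ bad k) → κ ≤ cnt i) (p : ℕ) :
    κ ^ p ≤ 2 ^ p * (l 0 ^ p + (∑ i ∈ Finset.range (n + 1), (cnt i - l i) ^ p +
      ∑ i ∈ Finset.range n, if bad i then l (i + 1) ^ p else 0)) := by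
  induction n with
  | zero =>
    simpa using pow_le_two_pow_mul_add_tsub_pow (hκ 0 le_rfl (by simp)) (l 0) p
  | succ n ih =>
    by_cases hbad : bad n
    · refine (pow_le_two_pow_mul_add_tsub_pow (hκ (n + 1) le_rfl (by omega)) (l (n + 1)) p).trans
        (mul_le_mul' le_rfl (le_trans ?_ le_add_self))
      rw [Finset.sum_range_succ _ (n + 1),
        Finset.sum_range_succ (fun i => if bad i then l (i + 1) ^ p else 0) n, if_pos hbad,
        add_comm (l (n + 1) ^ p)]
      exact add_le_add le_add_self le_add_self
    · refine (ih fun i hi hgood => hκ i (by omega) fun k hik hk => ?_).trans ?_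
      · rcases (Nat.lt_succ_iff.1 hk).eq_or_lt with rfl | hkn
        exacts [hbad, hgood k hik hkn]
      · gcongr <;> omega

variable {Ω F : Type*} [MeasurableSpace Ω] [MeasurableSpace F] {P : Measure Ω}
  [IsProbabilityMeasure P] {ν : Measure F} {N : ℕ} {Y : Fin N → Ω → F}

lemma lintegral_pow_tsub_le_of_last_failure (hY : IsIIDSample Y ν P) {p : ℕ} (hp : p ≠ 0)
    {κ : Ω → ℝ≥0∞} {n : ℕ} {B : ℕ → Set F} (hB : ∀ i, MeasurableSet (B i)) {l : ℕ → ℝ}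
    (hl : ∀ i ≤ n, N * ν.real (B i) ≤ l i / 4) {bad : ℕ → Set Ω}
    (hκ : ∀ᵐ ω ∂P, ∀ i ≤ n, (∀ k, i ≤ k → k < n → ω ∉ bad k) → κ ω ≤ hits (B i) fun j => Y j ω) :
    ∫⁻ ω, κ ω ^ p - 2 ^ p * ENNReal.ofReal (l 0) ^ p ∂P ≤
      2 ^ p * (∑ i ∈ Finset.range (n + 1), ENNReal.ofReal (p.factorial * Real.exp (-(l i / 2))) +
        ∑ i ∈ Finset.range n, ENNReal.ofReal (l (i + 1)) ^ p * P (bad i)) := by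
  classical
  have hcount : ∀ i, AEMeasurable (fun ω =>
      ((hits (B i) fun j => Y j ω : ℝ≥0∞) - ENNReal.ofReal (l i)) ^ p) P := by
    intro i
    have hmeas : AEMeasurable (fun ω => (hits (B i) fun j => Y j ω : ℝ)) P :=
      (measurable_hits (hB i) measurable_id).comp_aemeasurable
        (aemeasurable_pi_lambda _ fun j => (hY.hasLaw j).aemeasurable)
    simp_rw [← ENNReal.ofReal_natCast]
    exact (hmeas.ennreal_ofReal.sub_const _).pow_const p
  calc ∫⁻ ω, κ ω ^ p - 2 ^ p * ENNReal.ofReal (l 0) ^ p ∂P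
      ≤ ∫⁻ ω, 2 ^ p * (∑ i ∈ Finset.range (n + 1),
            ((hits (B i) fun j => Y j ω : ℝ≥0∞) - ENNReal.ofReal (l i)) ^ p +
          ∑ i ∈ Finset.range n, (toMeasurable P (bad i)).indicator
            (fun _ => ENNReal.ofReal (l (i + 1)) ^ p) ω) ∂P := by
        refine lintegral_mono_ae (hκ.mono fun ω hω => ?_)
        rw [tsub_le_iff_left, ← mul_add]
        exact pow_le_of_forall_le_of_last_failure (l := fun i => ENNReal.ofReal (l i))
          (fun i hi hgood => hω i hi fun k hik hkn hbad =>
            hgood k hik hkn (subset_toMeasurable P _ hbad)) p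
    _ = 2 ^ p * (∑ i ∈ Finset.range (n + 1),
            ∫⁻ ω, ((hits (B i) fun j => Y j ω : ℝ≥0∞) - ENNReal.ofReal (l i)) ^ p ∂P +
          ∑ i ∈ Finset.range n, ENNReal.ofReal (l (i + 1)) ^ p * P (bad i)) := by
        rw [lintegral_const_mul' _ _ (ENNReal.pow_ne_top ENNReal.ofNat_ne_top),
          lintegral_add_left' (Finset.aemeasurable_fun_sum _ fun i _ => hcount i),
          lintegral_finsetSum' _ fun i _ => hcount i, lintegral_finsetSum _ fun i _ =>
            measurable_const.indicator (measurableSet_toMeasurable P _)]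
        simp_rw [lintegral_indicator_const (measurableSet_toMeasurable P _), measure_toMeasurable]
    _ ≤ _ := by
        gcongr with i hi
        exact lintegral_hits_tsub_pow_le hY (hB i) hp
          (hl i (Nat.lt_succ_iff.1 (Finset.mem_range.1 hi)))

end Domination

section LocalSampling

variable {Ω : Type*} [MeasurableSpace Ω] {d m p : ℕ} {N₁ M : ℕ → ℕ} {P : Measure Ω}
  {𝒳 𝒵 : Set (E d)} {φ : E d → E m} {X Z : ℕ → Ω → E d} {f₀ f₁ : E m → ℝ≥0} {x : E d}
  {S : Finset (E m)} {ε : ℝ}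

lemma tendsto_mul_sum_ofReal_exp (hrates : MatchingRates N₁ M) (hm : 1 ≤ m) (hp : p ≠ 0) {c : ℝ}
    (hc : 0 < c) (I : ℕ → ℕ) :
    Tendsto (fun n : ℕ => ENNReal.ofReal (n / (M n * N₁ n)) ^ p * ∑ i ∈ Finset.range (I n),
      ENNReal.ofReal (p.factorial * Real.exp (-(c * (M n * N₁ n / n) * 2 ^ (i * m)))))
      atTop (𝓝 0) := by
  have hinv : Tendsto (fun n : ℕ => (n : ℝ) / (M n * N₁ n)) atTop (𝓝 0) :=
    hrates.tendsto_mul_div.inv_tendsto_atTop.congr fun n => inv_div _ _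
  have hpow : Tendsto (fun n : ℕ => ENNReal.ofReal (n / (M n * N₁ n)) ^ p) atTop (𝓝 0) := by
    simpa [hp] using ENNReal.Tendsto.pow (n := p) (ENNReal.tendsto_ofReal hinv)
  have hlim := ENNReal.Tendsto.mul_const (b := ENNReal.ofReal (p.factorial * (2 / c))) hpow
    (Or.inr ENNReal.ofReal_ne_top)
  rw [zero_mul] at hlim
  refine tendsto_of_tendsto_of_tendsto_of_le_of_le' tendsto_const_nhds hlim
    (Eventually.of_forall fun _ => zero_le) ?_
  filter_upwards [hrates.tendsto_mul_div.eventually_ge_atTop 1] with n hn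
  gcongr
  have ha : 0 < c * (M n * N₁ n / n) := by positivity
  have hsum := sum_pow_mul_exp_neg_le ha hm 0 (I n)
  rw [← ENNReal.ofReal_sum_of_nonneg fun _ _ => by positivity, ← Finset.mul_sum]
  gcongr
  simp only [pow_zero, one_mul, zero_add, Nat.factorial_one, Nat.cast_one, mul_one] at hsum
  refine hsum.trans ?_
  gcongr
  exact le_mul_of_one_le_right hc.le hn

/-- The assumptions on the samples that enter the analysis at the target point `x`: the two samples
of `φ X` and `φ Z` are i.i.d. with densities `f₀` and `f₁` continuous at `φ x`. -/
structure LocalSampling (P : Measure Ω) (𝒳 𝒵 : Set (E d)) (φ : E d → E m) (X Z : ℕ → Ω → E d)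
    (f₀ f₁ : E m → ℝ≥0) (x : E d) : Prop where
  iid_X : IsIIDSample (fun i => φ ∘ X i) (volume.withDensity fun u => (f₀ u : ℝ≥0∞)) P
  iid_Z : IsIIDSample (fun j => φ ∘ Z j) (volume.withDensity fun u => (f₁ u : ℝ≥0∞)) P
  mem_X : ∀ᵐ ω ∂P, ∀ i, X i ω ∈ 𝒳
  mem_Z : ∀ᵐ ω ∂P, ∀ j, Z j ω ∈ 𝒵
  subset : 𝒵 ⊆ 𝒳
  mem : x ∈ 𝒳
  measurable_f₀ : Measurable f₀
  measurable_f₁ : Measurable f₁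
  pos : 0 < f₀ (φ x)
  continuousAt_f₀ : ContinuousAt f₀ (φ x)
  continuousAt_f₁ : ContinuousAt f₁ (φ x)

/-- The constant `G` for which `matchScale m M G` is the radius of the ball around `c` that is
expected to contain `M` of the observations with density `f`. -/
def matchConst (f : E m → ℝ≥0) (c : E m) : ℝ := (f c * volume.real (Metric.ball (0 : E m) 1))⁻¹

lemma matchConst_pos {f : E m → ℝ≥0} {c : E m} (hf : 0 < f c) : 0 < matchConst f c := by
  have := measureReal_unit_ball_pos (volume : Measure (E m))
  unfold matchConst
  positivity

lemma div_matchConst_lt (hm : 1 ≤ m) {f : E m → ℝ≥0} {c : E m} (hf : 0 < f c) :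
    4 / (32 ^ m * matchConst f c) <
      f c * (volume.real (Metric.ball (0 : E m) 1) * (1 / 4) ^ m) := by
  have hG := matchConst_pos hf
  have hpow : (4 : ℝ) < 8 ^ m :=
    lt_of_lt_of_le (by norm_num) (pow_le_pow_right₀ (by norm_num : (1 : ℝ) ≤ 8) hm)
  rw [div_lt_iff₀ (by positivity)]
  calc (4 : ℝ) < 8 ^ m := hpow
    _ = (1 / 4) ^ m * 32 ^ m * ((matchConst f c)⁻¹ * matchConst f c) := by
        rw [inv_mul_cancel₀ hG.ne', ← mul_pow]
        norm_num
    _ = _ := by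
        rw [matchConst, inv_inv]
        ring

/-- The ball of radius `2 ^ i * t` around `c` when `i ≤ I`, and the whole space when `i > I`: it
contains the matches of `x`, for `c = φ x`, when the scales `i, …, I` are good. -/
def dyadicRegion (c : E m) (t : ℝ) (I i : ℕ) : Set (E m) := {y | i ≤ I → dist y c < 2 ^ i * t}

lemma dyadicRegion_of_le (c : E m) (t : ℝ) {I i : ℕ} (hi : i ≤ I) :
    dyadicRegion c t I i = Metric.ball c (2 ^ i * t) := by
  ext y
  simp [dyadicRegion, hi]

lemma measurableSet_dyadicRegion (c : E m) (t : ℝ) (I i : ℕ) :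
    MeasurableSet (dyadicRegion c t I i) := by
  by_cases hi : i ≤ I
  · rw [dyadicRegion_of_le c t hi]
    exact measurableSet_ball
  · simp [dyadicRegion, hi]

section Rescaling

variable {n K : ℕ} {C G : ℝ}

lemma div_mul_level (hm : 1 ≤ m) (hG : 0 ≤ G) (hM : 1 ≤ M n) (hMn : M n ≤ n) (hK : 0 < K) (C : ℝ)
    (i : ℕ) : n / (M n * K) * (4 * K * (C * (2 ^ i * matchScale m M G n) ^ m)) =
      4 * C * G * 2 ^ (i * m) := by
  have hM0 : (0 : ℝ) < M n := by exact_mod_cast hM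
  have hn0 : (0 : ℝ) < n := by exact_mod_cast hM.trans hMn
  have hK0 : (0 : ℝ) < K := by exact_mod_cast hK
  rw [mul_pow, matchScale_pow hm hG, pow_mul]
  field_simp

lemma ofReal_pow_mul_ofReal_level_pow (hm : 1 ≤ m) (hG : 0 ≤ G) (hC : 0 ≤ C) (hM : 1 ≤ M n)
    (hMn : M n ≤ n) (hK : 0 < K) (p i : ℕ) :
    ENNReal.ofReal (n / (M n * K)) ^ p *
      ENNReal.ofReal (4 * K * (C * (2 ^ (i + 1) * matchScale m M G n) ^ m)) ^ p =
        ENNReal.ofReal (4 * C * G * 2 ^ m) ^ p * 2 ^ (i * m * p) := by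
  rw [← mul_pow, ← ENNReal.ofReal_mul (by positivity), div_mul_level hm hG hM hMn hK, add_one_mul,
    pow_add, mul_comm (2 ^ (i * m)), ← mul_assoc, ENNReal.ofReal_mul (by positivity), mul_pow,
    ENNReal.ofReal_pow zero_le_two, ENNReal.ofReal_ofNat, ← pow_mul]

lemma ofReal_ratioEst_pow_tsub (hm : 1 ≤ m) (hG : 0 ≤ G) (hM : 1 ≤ M n)
    (hMn : M n ≤ n) (hK : 0 < K) (p : ℕ) (ψ : E d → E m) (xs : Fin n → E d) (zs : Fin K → E d) :
    ENNReal.ofReal (ratioEst 𝒵 (M n) ψ xs zs x) ^ p - 2 ^ p * ENNReal.ofReal (4 * C * G) ^ p =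
      ENNReal.ofReal (n / (M n * K)) ^ p *
        (ENNReal.ofReal (matchCount 𝒵 (M n) ψ xs zs x) ^ p -
          2 ^ p * ENNReal.ofReal (4 * K * (C * matchScale m M G n ^ m)) ^ p) := by
  have hratio : ratioEst 𝒵 (M n) ψ xs zs x = n / (M n * K) * matchCount 𝒵 (M n) ψ xs zs x := by
    rw [ratioEst]
    field_simp
  have hlevel := div_mul_level hm hG hM hMn hK C 0
  simp only [pow_zero, one_mul, zero_mul, mul_one] at hlevel
  rw [ENNReal.mul_sub fun _ _ => ENNReal.pow_ne_top ENNReal.ofReal_ne_top, hratio,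
    ENNReal.ofReal_mul (by positivity), mul_pow, mul_left_comm _ (2 ^ p), ← hlevel,
    ENNReal.ofReal_mul (p := n / (M n * K)) (by positivity), mul_pow _ _ p]

end Rescaling

namespace LocalSampling

lemma exists_ball_mass_bounds (h : LocalSampling P 𝒳 𝒵 φ X Z f₀ f₁ x) (hm : 1 ≤ m)
    (S : Finset (E m)) : ∃ u ∈ Set.Ioc (0 : ℝ) 1, ∃ C > 0, 1 ≤ C * u ^ m ∧ ∀ t ∈ Set.Ioc 0 u,
      (∀ s ∈ S, 4 / (32 ^ m * matchConst f₀ (φ x)) * t ^ m ≤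
        (volume.withDensity fun u => (f₀ u : ℝ≥0∞)).real
          (Metric.ball (φ x + t • s) (1 / 4 * t))) ∧
      (volume.withDensity fun u => (f₁ u : ℝ≥0∞)).real (Metric.ball (φ x) t) ≤ C * t ^ m := by
  have hball := (eventually_le_withDensity_real_ball (μ := (volume : Measure (E m)))
    h.measurable_f₀ h.continuousAt_f₀ S (by norm_num : (0 : ℝ) < 1 / 4)
    (by simpa using div_matchConst_lt hm h.pos)).and
    (eventually_withDensity_real_ball_le (μ := (volume : Measure (E m)))
      h.measurable_f₁ h.continuousAt_f₁ (lt_add_one _))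
  obtain ⟨u, hu, hbounds⟩ :=
    mem_nhdsGT_iff_exists_Ioc_subset.1 (hball.and (Ioc_mem_nhdsGT one_pos))
  set C := f₁ (φ x) * volume.real (Metric.ball (0 : E m) 1) + 1
  have hu0 : (0 : ℝ) < u := hu
  have : 0 < C := by positivity
  refine ⟨u, ⟨hu0, (hbounds ⟨hu0, le_rfl⟩).2.2⟩, C + 1 / u ^ m, by positivity, ?_,
    fun t ht => ⟨?_, ?_⟩⟩
  · rw [add_mul, one_div_mul_cancel (by positivity)]
    exact le_add_of_nonneg_left (by positivity)
  · simpa using (hbounds ht).1.1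
  · have ht0 : 0 < t := ht.1
    refine (hbounds ht).1.2.trans ?_
    rw [finrank_euclideanSpace_fin]
    gcongr
    exact le_add_of_nonneg_right (by positivity)

lemma ae_matchCount_le_hits (h : LocalSampling P 𝒳 𝒵 φ X Z f₀ f₁ x)
    (hS : Metric.IsCover (1 / 8) (Metric.closedBall (0 : E m) 1) S) (hε : 0 ≤ ε)
    (hε32 : ε ≤ 1 / 32) {t : ℝ} (ht : 0 < t) (I : ℕ) {n k : ℕ} (K : ℕ) (hk : 1 ≤ k) (hkn : k ≤ n)
    (ψ : Ω → E d → E m) : ∀ᵐ ω ∂P, ∀ i,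
      (∀ l, i ≤ l → l ≤ I → GoodScale 𝒳 φ (ψ ω) ε S k (fun j : Fin n => X j ω) x t I l) →
      matchCount 𝒵 k (ψ ω) (fun i : Fin n => X i ω) (fun j : Fin K => Z j ω) x ≤
        hits (dyadicRegion (φ x) t I i) fun j : Fin K => φ (Z j ω) := by
  filter_upwards [h.mem_X, h.mem_Z] with ω hX hZ i hgood
  rw [matchCount_eq_hits, Nat.cast_le]
  refine hits_le_hits fun j hj hiI => ?_
  rw [dist_eq_norm]
  exact norm_sub_lt_of_mem_catchment hS ht hiI hε hε32 hgood hk hkn h.mem (h.subset (hZ j))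
    (fun i => hX i) hj

variable [IsProbabilityMeasure P] {u C t : ℝ} {I n K k : ℕ}

lemma measureReal_dyadicRegion_le (h : LocalSampling P 𝒳 𝒵 φ X Z f₀ f₁ x) (hC : 0 ≤ C)
    (hu : 0 < u) (hCu : 1 ≤ C * u ^ m)
    (hmass : ∀ r ∈ Set.Ioc 0 u,
      (volume.withDensity fun v => (f₁ v : ℝ≥0∞)).real (Metric.ball (φ x) r) ≤ C * r ^ m)
    (ht : 0 < t) (hI : 2 ^ I * t ≤ u) (huI : u ≤ 2 ^ (I + 1) * t) (i : ℕ) :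
    (volume.withDensity fun v => (f₁ v : ℝ≥0∞)).real (dyadicRegion (φ x) t I i) ≤
      C * (2 ^ i * t) ^ m := by
  have : IsProbabilityMeasure (volume.withDensity fun v => (f₁ v : ℝ≥0∞)) :=
    (h.iid_Z.hasLaw 0).isProbabilityMeasure_iff.1 ‹_›
  by_cases hiI : i ≤ I
  · rw [dyadicRegion_of_le _ _ hiI]
    refine hmass _ ⟨by positivity, le_trans ?_ hI⟩
    gcongr
    exact one_le_two
  · refine measureReal_le_one.trans (hCu.trans ?_)
    have hIi : (2 : ℝ) ^ (I + 1) ≤ 2 ^ i := pow_le_pow_right₀ one_le_two (by omega)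
    gcongr
    exact huI.trans (by gcongr)

lemma lintegral_matchCount_pow_tsub_le (h : LocalSampling P 𝒳 𝒵 φ X Z f₀ f₁ x)
    (hS : Metric.IsCover (1 / 8) (Metric.closedBall (0 : E m) 1) S) (hp : p ≠ 0) (hε : 0 ≤ ε)
    (hε32 : ε ≤ 1 / 32) (hC : 0 ≤ C) (hu : 0 < u) (hCu : 1 ≤ C * u ^ m)
    (hmass : ∀ r ∈ Set.Ioc 0 u,
      (volume.withDensity fun v => (f₁ v : ℝ≥0∞)).real (Metric.ball (φ x) r) ≤ C * r ^ m)
    (ht : 0 < t) (hI : 2 ^ I * t ≤ u) (huI : u ≤ 2 ^ (I + 1) * t) (K : ℕ) (hk : 1 ≤ k)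
    (hkn : k ≤ n) (ψ : Ω → E d → E m) :
    ∫⁻ ω, ENNReal.ofReal (matchCount 𝒵 k (ψ ω) (fun i : Fin n => X i ω)
        (fun j : Fin K => Z j ω) x) ^ p - 2 ^ p * ENNReal.ofReal (4 * K * (C * t ^ m)) ^ p ∂P ≤
      2 ^ p * (∑ i ∈ Finset.range (I + 2),
          ENNReal.ofReal (p.factorial * Real.exp (-(2 * K * (C * (2 ^ i * t) ^ m)))) +
        ∑ i ∈ Finset.range (I + 1), ENNReal.ofReal (4 * K * (C * (2 ^ (i + 1) * t) ^ m)) ^ p *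
          P {ω | ¬ GoodScale 𝒳 φ (ψ ω) ε S k (fun j : Fin n => X j ω) x t I i}) := by
  have hl : ∀ i ≤ I + 1, K * (volume.withDensity fun v => (f₁ v : ℝ≥0∞)).real
      (dyadicRegion (φ x) t I i) ≤ 4 * K * (C * (2 ^ i * t) ^ m) / 4 := fun i _ =>
    calc _ ≤ K * (C * (2 ^ i * t) ^ m) := by
          gcongr
          exact h.measureReal_dyadicRegion_le hC hu hCu hmass ht hI huI i
      _ = _ := by ring
  have hfailure := lintegral_pow_tsub_le_of_last_failure (h.iid_Z.take K) hp
    (κ := fun ω => ENNReal.ofReal (matchCount 𝒵 k (ψ ω) (fun i : Fin n => X i ω)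
      (fun j : Fin K => Z j ω) x)) (measurableSet_dyadicRegion (φ x) t I) hl
    (bad := fun i => {ω | ¬ GoodScale 𝒳 φ (ψ ω) ε S k (fun j : Fin n => X j ω) x t I i}) <|
    (h.ae_matchCount_le_hits hS hε hε32 ht I K hk hkn ψ).mono fun ω hω i _ hgood => by
      rw [← ENNReal.ofReal_natCast]
      exact ENNReal.ofReal_le_ofReal
        (hω i fun l hil hlI => not_not.1 (hgood l hil (Nat.lt_succ_iff.2 hlI)))
  have hhalf : ∀ i, 4 * K * (C * (2 ^ i * t) ^ m) / 2 = 2 * K * (C * (2 ^ i * t) ^ m) :=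
    fun i => by ring
  simpa only [hhalf, pow_zero, one_mul] using hfailure

lemma lintegral_ratioEst_pow_tsub_le (h : LocalSampling P 𝒳 𝒵 φ X Z f₀ f₁ x)
    (hS : Metric.IsCover (1 / 8) (Metric.closedBall (0 : E m) 1) S) (hp : p ≠ 0) (hm : 1 ≤ m)
    (hε : 0 ≤ ε) (hε32 : ε ≤ 1 / 32) (hC : 0 ≤ C) (hu : 0 < u) (hCu : 1 ≤ C * u ^ m)
    (hmass : ∀ r ∈ Set.Ioc 0 u,
      (volume.withDensity fun v => (f₁ v : ℝ≥0∞)).real (Metric.ball (φ x) r) ≤ C * r ^ m)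
    {G : ℝ} (hG : 0 ≤ G) (ht : matchScale m M G n ∈ Set.Ioc 0 u) (hk : 1 ≤ M n) (hkn : M n ≤ n)
    (hK : 0 < K) (ψ : Ω → E d → E m) :
    ∫⁻ ω, ENNReal.ofReal (ratioEst 𝒵 (M n) (ψ ω) (fun i : Fin n => X i ω)
        (fun j : Fin K => Z j ω) x) ^ p - 2 ^ p * ENNReal.ofReal (4 * C * G) ^ p ∂P ≤
      2 ^ p * (ENNReal.ofReal (n / (M n * K)) ^ p *
          ∑ i ∈ Finset.range (topScale u (matchScale m M G n) + 2), ENNReal.ofReal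
            (p.factorial * Real.exp (-(2 * C * G * (M n * K / n) * 2 ^ (i * m)))) +
        ENNReal.ofReal (4 * C * G * 2 ^ m) ^ p *
          ∑ i ∈ Finset.range (topScale u (matchScale m M G n) + 1), 2 ^ (i * m * p) *
            P {ω | ¬ GoodScale 𝒳 φ (ψ ω) ε S (M n) (fun j : Fin n => X j ω) x
              (matchScale m M G n) (topScale u (matchScale m M G n)) i}) := by
  have hexponent : ∀ i, 2 * K * (C * (2 ^ i * matchScale m M G n) ^ m) =
      2 * C * G * (M n * K / n) * 2 ^ (i * m) := fun i => by
    rw [mul_pow, matchScale_pow hm hG, pow_mul]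
    ring
  have hcount := h.lintegral_matchCount_pow_tsub_le (n := n) (k := M n) hS hp hε hε32 hC hu hCu
    hmass ht.1 (two_pow_topScale_mul_le ht.1 ht.2) (lt_two_pow_topScale_succ_mul u ht.1).le K hk
    hkn ψ
  simp_rw [ofReal_ratioEst_pow_tsub hm hG hk hkn hK]
  rw [lintegral_const_mul' _ _ (ENNReal.pow_ne_top ENNReal.ofReal_ne_top)]
  refine (mul_le_mul' le_rfl hcount).trans_eq ?_
  rw [mul_left_comm, mul_add]
  simp_rw [hexponent]
  congr 2
  rw [Finset.mul_sum, Finset.mul_sum]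
  refine Finset.sum_congr rfl fun i _ => ?_
  rw [← mul_assoc, ofReal_pow_mul_ofReal_level_pow hm hG hC hk hkn hK, mul_assoc]

lemma exists_tendsto_lintegral_ratioEst_pow_tsub {ψ : ℕ → Ω → E d → E m}
    (h : LocalSampling P 𝒳 𝒵 φ X Z f₀ f₁ x) (hm : 1 ≤ m) (hp : p ≠ 0)
    (hrates : MatchingRates N₁ M) (hψ : DyadicErrorCondition P 𝒳 φ ψ M p) :
    ∃ C : ℝ≥0∞, C ≠ ∞ ∧ Tendsto (fun n => ∫⁻ ω, ENNReal.ofReal (ratioEst 𝒵 (M n) (ψ n ω)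
      (fun i : Fin n => X i ω) (fun j : Fin (N₁ n) => Z j ω) x) ^ p - C ∂P) atTop (𝓝 0) := by
  obtain ⟨S, hS⟩ := exists_finset_isCover_closedBall (0 : E m) 1 (by norm_num : (0 : ℝ≥0) < 1 / 8)
  obtain ⟨u, ⟨hu, hu1⟩, C, hC, hCu, hmass⟩ := h.exists_ball_mass_bounds hm S
  set G : ℝ := 32 ^ m * matchConst f₀ (φ x)
  have hG : 0 < G := mul_pos (by positivity) (matchConst_pos h.pos)
  have hbad := tendsto_sum_measure_not_goodScale h.iid_X hrates hψ hm hG hu hu1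
    (by norm_num : (0 : ℝ) < 1 / 32) fun t ht => (hmass t ht).1
  have hscale : ∀ᶠ n in atTop, matchScale m M G n ∈ Set.Ioc 0 u :=
    (hrates.tendsto_matchScale hm hG).eventually (Ioc_mem_nhdsGT hu)
  refine ⟨2 ^ p * ENNReal.ofReal (4 * C * G) ^ p,
    ENNReal.mul_ne_top (ENNReal.pow_ne_top ENNReal.ofNat_ne_top)
      (ENNReal.pow_ne_top ENNReal.ofReal_ne_top), ?_⟩
  have hlim := ENNReal.Tendsto.const_mul ((tendsto_mul_sum_ofReal_exp hrates hm hp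
    (by positivity : 0 < 2 * C * G) fun n => topScale u (matchScale m M G n) + 2).add
    (ENNReal.Tendsto.const_mul (a := ENNReal.ofReal (4 * C * G * 2 ^ m) ^ p) hbad
      (Or.inr (ENNReal.pow_ne_top ENNReal.ofReal_ne_top))))
    (Or.inr (ENNReal.pow_ne_top (n := p) ENNReal.ofNat_ne_top : (2 : ℝ≥0∞) ^ p ≠ ∞))
  rw [mul_zero, add_zero, mul_zero] at hlim
  refine tendsto_of_tendsto_of_tendsto_of_le_of_le' tendsto_const_nhds hlim
    (Eventually.of_forall fun _ => zero_le) ?_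
  filter_upwards [hrates.eventually_le, hrates.eventually_pos, hscale] with n hM hN ht
  exact h.lintegral_ratioEst_pow_tsub_le hS hp hm (by norm_num) le_rfl hC.le hu hCu
    (fun r hr => (hmass r hr).2) hG.le ht hM.1 hM.2 hN (ψ n)

end LocalSampling

end LocalSampling

section HighProbability

variable {Ω ι : Type*} [MeasurableSpace Ω] {P : Measure Ω} {Q R : ℕ → Ω → Prop}

/-- The events `Q n` have outer probability tending to one; no measurability is assumed. -/
def WithHighProbability (P : Measure Ω) (Q : ℕ → Ω → Prop) : Prop :=
  Tendsto (fun n => P {ω | ¬ Q n ω}) atTop (𝓝 0)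

lemma WithHighProbability.mono (hQ : WithHighProbability P Q)
    (h : ∀ᶠ n in atTop, ∀ᵐ ω ∂P, Q n ω → R n ω) : WithHighProbability P R :=
  tendsto_of_tendsto_of_tendsto_of_le_of_le' tendsto_const_nhds hQ
    (Eventually.of_forall fun _ => zero_le)
    (h.mono fun _ hn => measure_mono_ae (hn.mono fun _ hω hR hQω => hR (hω hQω)))

lemma WithHighProbability.and (hQ : WithHighProbability P Q) (hR : WithHighProbability P R) :
    WithHighProbability P fun n ω => Q n ω ∧ R n ω := by
  have hsum := Tendsto.add hQ hR
  rw [add_zero] at hsum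
  refine tendsto_of_tendsto_of_tendsto_of_le_of_le tendsto_const_nhds hsum (fun _ => zero_le)
    fun n => (measure_mono fun ω hω => ?_).trans (measure_union_le _ _)
  exact not_and_or.1 hω

lemma withHighProbability_forall_finset {S : Finset ι} {Q : ι → ℕ → Ω → Prop}
    (hQ : ∀ s ∈ S, WithHighProbability P (Q s)) :
    WithHighProbability P fun n ω => ∀ s ∈ S, Q s n ω := by
  have hsum := tendsto_finsetSum S hQ
  rw [Finset.sum_const_zero] at hsum
  refine tendsto_of_tendsto_of_tendsto_of_le_of_le tendsto_const_nhds hsum (fun _ => zero_le)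
    fun n => (measure_mono fun ω hω => ?_).trans (measure_biUnion_finset_le _ _)
  simpa using hω

lemma tendstoInMeasure_const_iff {U : ℕ → Ω → ℝ} {c : ℝ} :
    TendstoInMeasure P U atTop (fun _ => c) ↔
      ∀ θ > 0, WithHighProbability P fun n ω => |U n ω - c| < θ := by
  simp only [tendstoInMeasure_iff_dist, WithHighProbability, Real.dist_eq, not_lt]

end HighProbability

section Sandwich

variable {d m N K M : ℕ} {𝒳 𝒵 : Set (E d)} {φ ψ : E d → E m} {ε r : ℝ} {η : ℝ≥0}
  {xs : Fin N → E d} {zs : Fin K → E d} {x : E d} {S T : Finset (E m)}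

lemma matchCount_le_hits_ball (hS : Metric.IsCover (1 / 8) (Metric.closedBall (0 : E m) 1) S)
    (hT : Metric.IsCover η (Metric.closedBall (0 : E m) 32) T) (hr : 0 < r) (hε : 0 ≤ ε)
    (hε32 : ε ≤ 1 / 32) (hεη : ε * 32 ≤ η) {I : ℕ}
    (hgood : ∀ i ≤ I, GoodScale 𝒳 φ ψ ε S M xs x (32 * r) I i)
    (hfilled : NetFilled T (φ x) r (1 + η) M fun j => φ (xs j))
    (hM : 1 ≤ M) (hMN : M ≤ N) (hx : x ∈ 𝒳) (hxs : ∀ i, xs i ∈ 𝒳) (hzs : ∀ j, zs j ∈ 𝒳) :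
    matchCount 𝒵 M ψ xs zs x ≤
      hits (Metric.ball (φ x) ((1 + 4 * η) * r)) fun j => φ (zs j) := by
  rw [matchCount_eq_hits, Nat.cast_le]
  refine hits_le_hits fun j hj => ?_
  have hnear := norm_sub_lt_of_mem_catchment hS (by positivity) (Nat.zero_le I) hε hε32
    (fun i _ => hgood i) hM hMN hx (hzs j) hxs hj
  have hinc := (hgood 0 (Nat.zero_le I)).incrementBound
  rw [pow_zero, one_mul] at hnear hinc
  rw [Metric.mem_ball, dist_eq_norm]
  exact norm_sub_lt_of_mem_catchment_of_netFilled hr hε hεη hT hfilled hinc hM hMN hx (hzs j) hxs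
    hnear.le hj

lemma hits_ball_le_matchCount (hT : Metric.IsCover η (Metric.closedBall (0 : E m) 32) T)
    (hr : 0 < r) (hη : η ≤ 1 / 8) (hε : 0 ≤ ε) (hεη : ε * 32 ≤ η)
    (hinc : IncrementBound 𝒳 φ ψ ε (32 * r))
    (hcount : ∀ s ∈ T, hits (Metric.ball (φ x + r • s) ((1 - η) * r)) (fun j => φ (xs j)) < M)
    (hM : 1 ≤ M) (hMN : M ≤ N) (hx : x ∈ 𝒳) (hxs : ∀ i, xs i ∈ 𝒳) (h𝒵 : 𝒵 ⊆ 𝒳)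
    (hzs : ∀ j, zs j ∈ 𝒵) :
    hits (Metric.ball (φ x) ((1 - 4 * η) * r)) (fun j => φ (zs j)) ≤
      matchCount 𝒵 M ψ xs zs x := by
  rw [matchCount_eq_hits, Nat.cast_le]
  refine hits_le_hits fun j hj => ?_
  rw [Metric.mem_ball, dist_eq_norm] at hj
  exact mem_catchment_of_hits_ball_lt hr hη hε hεη (by norm_num) hT hcount hinc hM hMN hx
    (h𝒵 (hzs j)) (hzs j) hxs hj

end Sandwich

lemma exists_dilation_close (r : ℝ) (m : ℕ) {θ : ℝ} (hθ : 0 < θ) :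
    ∃ η : ℝ≥0, 0 < η ∧ (η : ℝ) < 1 / 8 ∧ |r * (1 + 4 * η) ^ m - r| < θ ∧
      |r * (1 - 4 * η) ^ m - r| < θ := by
  have hout : Tendsto (fun η : ℝ≥0 => |r * (1 + 4 * (η : ℝ)) ^ m - r|) (𝓝 0) (𝓝 0) :=
    Continuous.tendsto' (by fun_prop) _ _ (by simp)
  have hin : Tendsto (fun η : ℝ≥0 => |r * (1 - 4 * (η : ℝ)) ^ m - r|) (𝓝 0) (𝓝 0) :=
    Continuous.tendsto' (by fun_prop) _ _ (by simp)
  have hsmall : Tendsto (fun η : ℝ≥0 => (η : ℝ)) (𝓝 0) (𝓝 0) :=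
    Continuous.tendsto' (by fun_prop) _ _ (by simp)
  have hev := ((hsmall.eventually_lt_const (by norm_num : (0 : ℝ) < 1 / 8)).and
    ((hout.eventually_lt_const hθ).and (hin.eventually_lt_const hθ))).filter_mono
    (nhdsWithin_le_nhds (s := Set.Ioi 0))
  obtain ⟨η, hη, hη0⟩ := (hev.and self_mem_nhdsWithin).exists
  exact ⟨η, hη0, hη⟩

section Consistency

variable {Ω : Type*} [MeasurableSpace Ω] {d m p : ℕ} {N₁ M : ℕ → ℕ} {P : Measure Ω}
  {𝒳 𝒵 : Set (E d)} {φ : E d → E m} {ψ : ℕ → Ω → E d → E m} {X Z : ℕ → Ω → E d}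
  {f f₀ f₁ : E m → ℝ≥0} {c : E m} {x : E d}

lemma MatchingRates.tendsto_mul_measureReal_ball_div (hrates : MatchingRates N₁ M) (hm : 1 ≤ m)
    (hf : Measurable f) (hc : ContinuousAt f c) (hf₀ : 0 < f₀ c) (v : E m) {β : ℝ} (hβ : 0 < β) :
    Tendsto (fun n : ℕ => n * (volume.withDensity fun u => (f u : ℝ≥0∞)).real
      (Metric.ball (c + matchScale m M (matchConst f₀ c) n • v)
        (β * matchScale m M (matchConst f₀ c) n)) / M n) atTop (𝓝 (f c / f₀ c * β ^ m)) := by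
  have hG := matchConst_pos hf₀
  have hV := measureReal_unit_ball_pos (volume : Measure (E m))
  have hlim := ((tendsto_withDensity_real_ball_div_pow (μ := volume) hf hc v hβ).comp
    (hrates.tendsto_matchScale hm hG)).mul_const (matchConst f₀ c)
  rw [finrank_euclideanSpace_fin] at hlim
  have hvalue : f c * (volume.real (Metric.ball (0 : E m) 1) * β ^ m) * matchConst f₀ c =
      f c / f₀ c * β ^ m := by
    rw [matchConst]
    have : (0 : ℝ) < f₀ c := hf₀
    field_simp
  rw [← hvalue]
  refine hlim.congr' ?_
  filter_upwards [hrates.eventually_le] with n hn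
  have hM : (0 : ℝ) < M n := by exact_mod_cast hn.1
  have hn' : (0 : ℝ) < n := by exact_mod_cast hn.1.trans hn.2
  rw [Function.comp_apply, matchScale_pow hm hG.le]
  field_simp

variable [IsProbabilityMeasure P]

namespace LocalSampling

lemma tendstoInMeasure_hits_X_div (h : LocalSampling P 𝒳 𝒵 φ X Z f₀ f₁ x)
    (hrates : MatchingRates N₁ M) (hm : 1 ≤ m) (v : E m) {β : ℝ} (hβ : 0 < β) :
    TendstoInMeasure P (fun n ω =>
      (hits (Metric.ball (φ x + matchScale m M (matchConst f₀ (φ x)) n • v)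
        (β * matchScale m M (matchConst f₀ (φ x)) n)) fun i : Fin n => φ (X i ω) : ℝ) / M n)
      atTop fun _ => β ^ m := by
  have hmean := hrates.tendsto_mul_measureReal_ball_div hm h.measurable_f₀ h.continuousAt_f₀ h.pos
    v hβ
  rw [div_self (by exact_mod_cast h.pos.ne'), one_mul] at hmean
  exact tendstoInMeasure_hits_div h.iid_X (fun _ => measurableSet_ball)
    (tendsto_natCast_atTop_atTop.comp hrates.tendsto_matches) hmean

lemma tendstoInMeasure_hits_Z_div (h : LocalSampling P 𝒳 𝒵 φ X Z f₀ f₁ x)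
    (hrates : MatchingRates N₁ M) (hm : 1 ≤ m) {β : ℝ} (hβ : 0 < β) :
    TendstoInMeasure P (fun n ω => n / N₁ n *
      ((hits (Metric.ball (φ x) (β * matchScale m M (matchConst f₀ (φ x)) n))
        fun j : Fin (N₁ n) => φ (Z j ω) : ℝ) / M n))
      atTop fun _ => f₁ (φ x) / f₀ (φ x) * β ^ m := by
  have hmean := hrates.tendsto_mul_measureReal_ball_div hm h.measurable_f₁ h.continuousAt_f₁ h.pos
    0 hβ
  simp only [smul_zero, add_zero] at hmean
  have hmean' : Tendsto (fun n : ℕ => N₁ n * (volume.withDensity fun u => (f₁ u : ℝ≥0∞)).real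
      (Metric.ball (φ x) (β * matchScale m M (matchConst f₀ (φ x)) n)) / (M n * N₁ n / n)) atTop
      (𝓝 (f₁ (φ x) / f₀ (φ x) * β ^ m)) := by
    refine hmean.congr' ?_
    filter_upwards [hrates.eventually_pos] with n hn
    have : (0 : ℝ) < N₁ n := by exact_mod_cast hn
    field_simp
  have hlaw := tendstoInMeasure_hits_div h.iid_Z (fun _ => measurableSet_ball)
    hrates.tendsto_mul_div hmean'
  refine hlaw.congr_left fun n => Eventually.of_forall fun ω => ?_
  simp only [Function.comp_apply, div_eq_mul_inv, mul_inv, inv_inv]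
  ring

lemma withHighProbability_netFilled (h : LocalSampling P 𝒳 𝒵 φ X Z f₀ f₁ x)
    (hrates : MatchingRates N₁ M) (hm : 1 ≤ m) (T : Finset (E m)) {β : ℝ} (hβ : 1 < β) :
    WithHighProbability P fun n ω => NetFilled T (φ x) (matchScale m M (matchConst f₀ (φ x)) n) β
      (M n) fun i : Fin n => φ (X i ω) := by
  refine withHighProbability_forall_finset fun s _ => (tendstoInMeasure_const_iff.1
    (h.tendstoInMeasure_hits_X_div hrates hm s (one_pos.trans hβ)) (β ^ m - 1)
    (sub_pos.2 (one_lt_pow₀ hβ (by omega)))).mono ?_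
  filter_upwards [hrates.eventually_le] with n hn
  refine Eventually.of_forall fun ω hω => ?_
  have hlt := (abs_lt.1 hω).1
  have hM : (0 : ℝ) < M n := by exact_mod_cast hn.1
  rw [neg_sub, sub_lt_sub_iff_right, one_lt_div hM] at hlt
  exact_mod_cast hlt.le

lemma withHighProbability_hits_lt (h : LocalSampling P 𝒳 𝒵 φ X Z f₀ f₁ x)
    (hrates : MatchingRates N₁ M) (hm : 1 ≤ m) (T : Finset (E m)) {β : ℝ} (hβ : 0 < β)
    (hβ1 : β < 1) :
    WithHighProbability P fun n ω => ∀ s ∈ T,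
      hits (Metric.ball (φ x + matchScale m M (matchConst f₀ (φ x)) n • s)
        (β * matchScale m M (matchConst f₀ (φ x)) n)) (fun i : Fin n => φ (X i ω)) < M n := by
  refine withHighProbability_forall_finset fun s _ => (tendstoInMeasure_const_iff.1
    (h.tendstoInMeasure_hits_X_div hrates hm s hβ) (1 - β ^ m)
    (sub_pos.2 (pow_lt_one₀ hβ.le hβ1 (by omega)))).mono ?_
  filter_upwards [hrates.eventually_le] with n hn
  refine Eventually.of_forall fun ω hω => ?_
  have hlt := (abs_lt.1 hω).2
  have hM : (0 : ℝ) < M n := by exact_mod_cast hn.1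
  rw [sub_lt_sub_iff_right, div_lt_one hM] at hlt
  exact_mod_cast hlt

lemma withHighProbability_goodScale (h : LocalSampling P 𝒳 𝒵 φ X Z f₀ f₁ x)
    (hrates : MatchingRates N₁ M) (hm : 1 ≤ m) (hψ : DyadicErrorCondition P 𝒳 φ ψ M p)
    (S : Finset (E m)) {ε : ℝ} (hε : 0 < ε) :
    WithHighProbability P fun n ω => ∃ I, ∀ i ≤ I,
      GoodScale 𝒳 φ (ψ n ω) ε S (M n) (fun j : Fin n => X j ω) x
        (32 * matchScale m M (matchConst f₀ (φ x)) n) I i := by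
  have hG := matchConst_pos h.pos
  obtain ⟨u, ⟨hu, hu1⟩, _, -, -, hmass⟩ := h.exists_ball_mass_bounds hm S
  have hgood : WithHighProbability P _ := tendsto_measure_not_forall_goodScale h.iid_X hrates hψ hm
    (by positivity : 0 < 32 ^ m * matchConst f₀ (φ x)) hu hu1 hε fun t ht => (hmass t ht).1
  simp only [mul_matchScale hm (by norm_num : (0 : ℝ) ≤ 32) hG.le] at hgood
  exact hgood.mono (Eventually.of_forall fun n => Eventually.of_forall fun ω hω => ⟨_, hω⟩)

lemma withHighProbability_matchCount_mem_Icc (h : LocalSampling P 𝒳 𝒵 φ X Z f₀ f₁ x)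
    (hrates : MatchingRates N₁ M) (hm : 1 ≤ m) (hψ : DyadicErrorCondition P 𝒳 φ ψ M p)
    {η : ℝ≥0} (hη : 0 < η) (hη8 : (η : ℝ) ≤ 1 / 8) :
    WithHighProbability P fun n ω =>
      matchCount 𝒵 (M n) (ψ n ω) (fun i : Fin n => X i ω) (fun j : Fin (N₁ n) => Z j ω) x ∈
        Set.Icc
          (hits (Metric.ball (φ x) ((1 - 4 * η) * matchScale m M (matchConst f₀ (φ x)) n))
            fun j : Fin (N₁ n) => φ (Z j ω) : ℝ)
          (hits (Metric.ball (φ x) ((1 + 4 * η) * matchScale m M (matchConst f₀ (φ x)) n))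
            fun j : Fin (N₁ n) => φ (Z j ω)) := by
  have hη' : (0 : ℝ) < η := hη
  obtain ⟨S, hS⟩ := exists_finset_isCover_closedBall (0 : E m) 1 (by norm_num : (0 : ℝ≥0) < 1 / 8)
  obtain ⟨T, hT⟩ := exists_finset_isCover_closedBall (0 : E m) 32 hη
  have hε : (0 : ℝ) < η / 32 := by positivity
  refine (((h.withHighProbability_goodScale hrates hm hψ S hε).and
    (h.withHighProbability_netFilled hrates hm T (by linarith : (1 : ℝ) < 1 + η))).and
    (h.withHighProbability_hits_lt hrates hm T (by linarith : (0 : ℝ) < 1 - η)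
      (by linarith))).mono ?_
  filter_upwards [hrates.eventually_le, (hrates.tendsto_matchScale hm
    (matchConst_pos h.pos)).eventually self_mem_nhdsWithin] with n hM ht
  filter_upwards [h.mem_X, h.mem_Z] with ω hX hZ
  rintro ⟨⟨⟨I, hgood⟩, hfilled⟩, hcount⟩
  have hinc := (hgood 0 (Nat.zero_le I)).incrementBound
  rw [pow_zero, one_mul] at hinc
  exact ⟨hits_ball_le_matchCount hT ht hη8 hε.le (by linarith) hinc hcount hM.1 hM.2 h.mem
      (fun i => hX i) h.subset fun j => hZ j,
    matchCount_le_hits_ball hS hT ht hε.le (by linarith) (by linarith) hgood hfilled hM.1 hM.2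
      h.mem (fun i => hX i) fun j => h.subset (hZ j)⟩

lemma tendstoInMeasure_ratioEst (h : LocalSampling P 𝒳 𝒵 φ X Z f₀ f₁ x)
    (hrates : MatchingRates N₁ M) (hm : 1 ≤ m) (hψ : DyadicErrorCondition P 𝒳 φ ψ M p) :
    TendstoInMeasure P (fun n ω => ratioEst 𝒵 (M n) (ψ n ω) (fun i : Fin n => X i ω)
      (fun j : Fin (N₁ n) => Z j ω) x) atTop fun _ => f₁ (φ x) / f₀ (φ x) := by
  refine tendstoInMeasure_const_iff.2 fun θ hθ => ?_
  obtain ⟨η, hη, hη8, hout, hin⟩ :=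
    exists_dilation_close (f₁ (φ x) / f₀ (φ x) : ℝ) m (half_pos hθ)
  have : (0 : ℝ) < η := hη
  refine (((h.withHighProbability_matchCount_mem_Icc hrates hm hψ hη hη8.le).and
    (tendstoInMeasure_const_iff.1 (h.tendstoInMeasure_hits_Z_div hrates hm
      (by linarith : (0 : ℝ) < 1 - 4 * η)) _ (half_pos hθ))).and
    (tendstoInMeasure_const_iff.1 (h.tendstoInMeasure_hits_Z_div hrates hm
      (by linarith : (0 : ℝ) < 1 + 4 * η)) _ (half_pos hθ))).mono
    (Eventually.of_forall fun n => Eventually.of_forall ?_)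
  rintro ω ⟨⟨⟨hlower, hupper⟩, hZin⟩, hZout⟩
  have hmono : ∀ {a b : ℝ}, a ≤ b → (n : ℝ) / N₁ n * (a / M n) ≤ n / N₁ n * (b / M n) :=
    fun hab => by gcongr
  have hge := hmono hlower
  have hle := hmono hupper
  rw [ratioEst, abs_lt]
  rw [abs_lt] at hZin hZout hin hout
  constructor <;> linarith

end LocalSampling

end Consistency

section ConvergenceOfIntegrals

variable {Ω ι F G : Type*} [MeasurableSpace Ω] {P : Measure Ω} {l : Filter ι}

lemma tendstoInMeasure_comp_of_continuousAt [PseudoEMetricSpace F] [PseudoEMetricSpace G]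
    {U : ι → Ω → F} {c : F} {g : F → G} (hg : ContinuousAt g c)
    (hU : TendstoInMeasure P U l fun _ => c) :
    TendstoInMeasure P (fun i ω => g (U i ω)) l fun _ => g c := by
  intro ε hε
  obtain ⟨δ, hδ, hball⟩ := EMetric.continuousAt_iff.1 hg ε hε
  refine tendsto_of_tendsto_of_tendsto_of_le_of_le tendsto_const_nhds (hU δ hδ)
    (fun _ => zero_le) fun i => measure_mono fun ω hω => ?_
  by_contra hlt
  exact (hball (not_le.1 hlt)).not_ge hω

variable [NormedAddCommGroup F] {V : ι → Ω → F} {c : F} {C : ℝ≥0∞}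

lemma lintegral_enorm_sub_le (V : Ω → F) (c : F) (C : ℝ≥0∞) (θ : ℝ≥0∞) :
    ∫⁻ ω, ‖V ω - c‖ₑ ∂P ≤ θ * P Set.univ +
      ((C + ‖c‖ₑ) * P {ω | θ ≤ ‖V ω - c‖ₑ} + ∫⁻ ω, ‖V ω‖ₑ - C ∂P) := by
  set B : Set Ω := toMeasurable P {ω | θ ≤ ‖V ω - c‖ₑ}
  have hB : MeasurableSet B := measurableSet_toMeasurable _ _
  have hpt : ∀ ω, ‖V ω - c‖ₑ ≤ θ + (B.indicator (fun _ => C + ‖c‖ₑ) ω + (‖V ω‖ₑ - C)) := by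
    intro ω
    by_cases hω : θ ≤ ‖V ω - c‖ₑ
    · rw [Set.indicator_of_mem (subset_toMeasurable P _ hω)]
      calc ‖V ω - c‖ₑ ≤ ‖V ω‖ₑ + ‖c‖ₑ := enorm_sub_le
        _ ≤ C + (‖V ω‖ₑ - C) + ‖c‖ₑ := by gcongr; exact le_add_tsub
        _ = C + ‖c‖ₑ + (‖V ω‖ₑ - C) := by ring
        _ ≤ _ := le_add_self
    · exact (not_le.1 hω).le.trans le_self_add
  refine (lintegral_mono hpt).trans_eq ?_
  rw [lintegral_add_left measurable_const, lintegral_add_left (measurable_const.indicator hB),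
    lintegral_const, lintegral_indicator_const hB, measure_toMeasurable]

lemma tendsto_lintegral_enorm_sub [IsFiniteMeasure P]
    (hV : TendstoInMeasure P V l fun _ => c) (hC : C ≠ ∞)
    (htail : Tendsto (fun i => ∫⁻ ω, ‖V i ω‖ₑ - C ∂P) l (𝓝 0)) :
    Tendsto (fun i => ∫⁻ ω, ‖V i ω - c‖ₑ ∂P) l (𝓝 0) := by
  rw [ENNReal.tendsto_nhds_zero]
  intro ε hε
  obtain ⟨θ, hθ, hθε⟩ := ENNReal.exists_nnreal_pos_mul_lt (measure_ne_top P Set.univ) hε.ne'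
  have hlim := tendsto_const_nhds (x := (θ : ℝ≥0∞) * P Set.univ).add ((ENNReal.Tendsto.const_mul
    (tendstoInMeasure_iff_enorm.1 hV θ (by exact_mod_cast hθ) ENNReal.coe_ne_top)
    (Or.inr (ENNReal.add_ne_top.2 ⟨hC, enorm_ne_top (x := c)⟩))).add htail)
  rw [mul_zero, add_zero, add_zero] at hlim
  filter_upwards [hlim.eventually_le_const hθε] with i hi
  exact (lintegral_enorm_sub_le (V i) c C θ).trans hi

lemma tendsto_integral_of_tendsto_lintegral_tsub [NormedSpace ℝ F] [CompleteSpace F]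
    [IsProbabilityMeasure P] (hV : TendstoInMeasure P V l fun _ => c)
    (hmeas : ∀ᶠ i in l, AEStronglyMeasurable (V i) P) (hC : C ≠ ∞)
    (htail : Tendsto (fun i => ∫⁻ ω, ‖V i ω‖ₑ - C ∂P) l (𝓝 0)) :
    Tendsto (fun i => ∫ ω, V i ω ∂P) l (𝓝 c) := by
  have hint : ∀ᶠ i in l, Integrable (V i) P := by
    filter_upwards [hmeas, htail.eventually_lt_const one_pos] with i hi hlt
    refine ⟨hi, (lintegral_mono fun ω => (le_add_tsub : _ ≤ C + (‖V i ω‖ₑ - C))).trans_lt ?_⟩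
    rw [lintegral_add_left measurable_const, lintegral_const, measure_univ, mul_one]
    exact ENNReal.add_lt_top.2 ⟨hC.lt_top, hlt.trans ENNReal.one_lt_top⟩
  have hlim := tendsto_integral_of_L1 (fun _ => c) aestronglyMeasurable_const hint
    (tendsto_lintegral_enorm_sub hV hC htail)
  rwa [integral_const, probReal_univ, one_smul] at hlim

end ConvergenceOfIntegrals

section Measurability

variable {d m N K M : ℕ} {𝒵 : Set (E d)} {Ψ : (Fin N → E d) × (Fin K → E d) × E d → E m}

lemma measurableSet_mem_catchment (hM : 1 ≤ M) (hMN : M ≤ N) (h𝒵 : MeasurableSet 𝒵)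
    (hΨ : Measurable Ψ) (x : E d) (j : Fin K) :
    MeasurableSet {w : (Fin N → E d) × (Fin K → E d) |
      w.2 j ∈ catchment 𝒵 M (fun s => Ψ (w.1, w.2, s)) w.1 x} := by
  have hz : Measurable fun w : (Fin N → E d) × (Fin K → E d) => w.2 j := by fun_prop
  have hdist : ∀ s : (Fin N → E d) × (Fin K → E d) → E d, Measurable s →
      Measurable fun w => ‖Ψ (w.1, w.2, s w) - Ψ (w.1, w.2, w.2 j)‖ := fun s hs => by fun_prop
  have hpairs : Measurable fun (w : (Fin N → E d) × (Fin K → E d)) (i : Fin N) =>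
      (‖Ψ (w.1, w.2, w.1 i) - Ψ (w.1, w.2, w.2 j)‖, ‖Ψ (w.1, w.2, x) - Ψ (w.1, w.2, w.2 j)‖) :=
    measurable_pi_lambda _ fun i => (hdist _ (by fun_prop)).prodMk (hdist _ measurable_const)
  simp_rw [mem_catchment_iff hM hMN]
  refine (hz h𝒵).inter ?_
  have hcount := measurableSet_lt
    (measurable_hits (measurableSet_lt measurable_fst measurable_snd) hpairs)
    (measurable_const (a := (M : ℝ)))
  simp only [Nat.cast_lt] at hcount
  exact hcount

lemma measurable_ratioEst (hM : 1 ≤ M) (hMN : M ≤ N) (h𝒵 : MeasurableSet 𝒵) (hΨ : Measurable Ψ)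
    (x : E d) :
    Measurable fun w : (Fin N → E d) × (Fin K → E d) =>
      ratioEst 𝒵 M (fun s => Ψ (w.1, w.2, s)) w.1 w.2 x := by
  have hcount : Measurable fun w : (Fin N → E d) × (Fin K → E d) =>
      matchCount 𝒵 M (fun s => Ψ (w.1, w.2, s)) w.1 w.2 x :=
    Finset.measurable_sum _ fun j _ => (measurable_const (a := (1 : ℝ))).indicator
      (measurableSet_mem_catchment hM hMN h𝒵 hΨ x j)
  exact (hcount.div_const _).const_mul _

variable {Ω : Type*} [MeasurableSpace Ω] {P : Measure Ω} {N₁ : ℕ → ℕ} {X Z : ℕ → Ω → E d}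

lemma aemeasurable_ratioEst_fitted (hX : ∀ i, AEMeasurable (X i) P)
    (hZ : ∀ j, AEMeasurable (Z j) P) (h𝒵 : MeasurableSet 𝒵) {φhat : Estimator d m N₁} {n : ℕ}
    (hφhat : Measurable fun w : (Fin n → E d) × (Fin (N₁ n) → E d) × E d =>
      φhat n w.1 w.2.1 w.2.2) (hM : 1 ≤ M) (hMn : M ≤ n) (x : E d) :
    AEMeasurable (fun ω => ratioEst 𝒵 M (fitted φhat X Z n ω) (fun i : Fin n => X i ω)
      (fun j : Fin (N₁ n) => Z j ω) x) P := by
  have hdata : AEMeasurable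
      (fun ω => ((fun i : Fin n => X i ω), fun j : Fin (N₁ n) => Z j ω)) P :=
    (aemeasurable_pi_lambda (fun ω (i : Fin n) => X i ω) fun i => hX i).prodMk
      (aemeasurable_pi_lambda (fun ω (j : Fin (N₁ n)) => Z j ω) fun j => hZ j)
  have hcomp := (measurable_ratioEst hM hMn h𝒵 hφhat x).comp_aemeasurable hdata
  simp only [Function.comp_def] at hcomp
  exact hcomp

end Measurability

section Moments

variable {Ω : Type*} [MeasurableSpace Ω] {d m p : ℕ} {N₁ M : ℕ → ℕ} {P : Measure Ω}
  {𝒳 𝒵 : Set (E d)} {φ : E d → E m} {ψ : ℕ → Ω → E d → E m} {X Z : ℕ → Ω → E d}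
  {f₀ f₁ : E m → ℝ≥0} {x : E d}

lemma ae_forall_mem_support {ι F : Type*} [Countable ι] [TopologicalSpace F]
    [HereditarilyLindelofSpace F] [MeasurableSpace F] {Y : ι → Ω → F}
    {μ : Measure F} (hY : ∀ i, HasLaw (Y i) μ P) : ∀ᵐ ω ∂P, ∀ i, Y i ω ∈ μ.support :=
  ae_all_iff.2 fun i => ae_of_ae_map (hY i).aemeasurable <| by
    rw [(hY i).map_eq]
    exact Measure.support_mem_ae

lemma LocalSampling.tendsto_integral_ratioEst_pow [IsProbabilityMeasure P]
    (h : LocalSampling P 𝒳 𝒵 φ X Z f₀ f₁ x) (hrates : MatchingRates N₁ M) (hm : 1 ≤ m)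
    (hp : p ≠ 0) (hψ : DyadicErrorCondition P 𝒳 φ ψ M p)
    (hmeas : ∀ᶠ n in atTop, AEMeasurable (fun ω => ratioEst 𝒵 (M n) (ψ n ω)
      (fun i : Fin n => X i ω) (fun j : Fin (N₁ n) => Z j ω) x) P) :
    Tendsto (fun n => ∫ ω, ratioEst 𝒵 (M n) (ψ n ω) (fun i : Fin n => X i ω)
      (fun j : Fin (N₁ n) => Z j ω) x ^ p ∂P) atTop (𝓝 ((f₁ (φ x) / f₀ (φ x)) ^ p)) := by
  obtain ⟨C, hC, htail⟩ := h.exists_tendsto_lintegral_ratioEst_pow_tsub hm hp hrates hψ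
  refine tendsto_integral_of_tendsto_lintegral_tsub (tendstoInMeasure_comp_of_continuousAt
    (continuous_pow p).continuousAt (h.tendstoInMeasure_ratioEst hrates hm hψ))
    (hmeas.mono fun n hn => (hn.pow_const p).aestronglyMeasurable) hC (htail.congr fun n => ?_)
  simp only [Real.enorm_of_nonneg (pow_nonneg (ratioEst_nonneg _ _ _ _ _ _) p),
    ENNReal.ofReal_pow (ratioEst_nonneg _ _ _ _ _ _)]

end Moments

end

end MatchingRatio

open MatchingRatio in
theorem mainTheorem5_general {d m : ℕ} (hm : 1 ≤ m)
    {Ω : Type*} [MeasurableSpace Ω] (P : Measure Ω) [IsProbabilityMeasure P]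
    (μ₀ μ₁ : Measure (E d))
    (hsupp : μ₁.support ⊆ μ₀.support)
    (φ : E d → E m) (hφ : Measurable φ)
    (f₀ f₁ : E m → ℝ≥0) (hf₀ : Measurable f₀) (hf₁ : Measurable f₁)
    (hν₀ : μ₀.map φ = volume.withDensity (fun u => (f₀ u : ℝ≥0∞)))
    (hν₁ : μ₁.map φ = volume.withDensity (fun u => (f₁ u : ℝ≥0∞)))
    (X Z : ℕ → Ω → E d) (hX : ∀ i, HasLaw (X i) μ₀ P) (hZ : ∀ j, HasLaw (Z j) μ₁ P)
    (hindX : iIndepFun X P) (hindZ : iIndepFun Z P)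
    (N₁ M : ℕ → ℕ)
    (hMn : Tendsto (fun n : ℕ => (M n : ℝ) / n) atTop (𝓝 0))
    (hMN : Tendsto (fun n : ℕ => (M n : ℝ) * N₁ n / n) atTop atTop)
    (hM : Tendsto M atTop atTop)
    (φhat : Estimator d m N₁)
    (hφhat : ∀ n, Measurable (fun w : (Fin n → E d) × (Fin (N₁ n) → E d) × E d =>
      φhat n w.1 w.2.1 w.2.2))
    (p : ℕ) (hp : 1 ≤ p)
    (x : E d) (hx : x ∈ μ₀.support)
    (hasm : (∃ q, 1 ≤ q ∧ q ≤ m ∧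
        UniformErrorCondition P μ₀.support μ₁.support φ φhat X Z M p q) ∨
      OscillationCondition P μ₀.support μ₁.support φ φhat X Z M p)
    (hpos : 0 < f₀ (φ x)) (hc₀ : ContinuousAt f₀ (φ x)) (hc₁ : ContinuousAt f₁ (φ x)) :
    Tendsto (fun n : ℕ => ∫ ω, ratioEst μ₁.support (M n) (fitted φhat X Z n ω)
        (fun i : Fin n => X i ω) (fun j : Fin (N₁ n) => Z j ω) x ^ p ∂P)
      atTop (𝓝 (((f₁ (φ x) / f₀ (φ x) : ℝ≥0) : ℝ) ^ p)) := by
  have hZ𝒵 := ae_forall_mem_support hZ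
  have hrates : MatchingRates N₁ M := ⟨hMn, hMN, hM⟩
  have hψ : DyadicErrorCondition P μ₀.support φ (fitted φhat X Z) M p := by
    rcases hasm with ⟨q, hq, hqm, h⟩ | h
    · exact h.dyadicErrorCondition hp hq hqm hZ𝒵
    · exact h.dyadicErrorCondition hm hp hZ𝒵
  have hsampling : LocalSampling P μ₀.support μ₁.support φ X Z f₀ f₁ x :=
    { iid_X := hν₀ ▸ (IsIIDSample.mk hX hindX).comp hφ
      iid_Z := hν₁ ▸ (IsIIDSample.mk hZ hindZ).comp hφ
      mem_X := ae_forall_mem_support hX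
      mem_Z := hZ𝒵
      subset := hsupp
      mem := hx
      measurable_f₀ := hf₀
      measurable_f₁ := hf₁
      pos := hpos
      continuousAt_f₀ := hc₀
      continuousAt_f₁ := hc₁ }
  rw [NNReal.coe_div]
  refine hsampling.tendsto_integral_ratioEst_pow hrates hm (Nat.one_le_iff_ne_zero.1 hp) hψ ?_
  filter_upwards [hrates.eventually_le] with n hn
  exact aemeasurable_ratioEst_fitted (fun i => (hX i).aemeasurable) (fun j => (hZ j).aemeasurable)
    Measure.isClosed_support.measurableSet (hφhat n) hn.1 hn.2 x

open MatchingRatio in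
theorem mainTheorem5 {d m : ℕ} (hm : 1 ≤ m)
    {Ω : Type*} [MeasurableSpace Ω] (P : Measure Ω) [IsProbabilityMeasure P]
    -- the laws of `X` and `Z`, with supports `𝒳` and `𝒵 ⊆ 𝒳`
    (μ₀ μ₁ : Measure (E d)) [IsProbabilityMeasure μ₀] [IsProbabilityMeasure μ₁]
    (hsupp : μ₁.support ⊆ μ₀.support)
    -- the transformation and the densities of `φ(X)` and `φ(Z)`
    (φ : E d → E m) (hφ : Measurable φ)
    (f₀ f₁ : E m → ℝ≥0) (hf₀ : Measurable f₀) (hf₁ : Measurable f₁)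
    (hν₀ : μ₀.map φ = volume.withDensity (fun u => (f₀ u : ℝ≥0∞)))
    (hν₁ : μ₁.map φ = volume.withDensity (fun u => (f₁ u : ℝ≥0∞)))
    (hac : μ₁.map φ ≪ μ₀.map φ)
    -- the two mutually independent i.i.d. samples
    (X Z : ℕ → Ω → E d) (hX : ∀ i, HasLaw (X i) μ₀ P) (hZ : ∀ j, HasLaw (Z j) μ₁ P)
    (hindep : iIndepFun (Sum.elim X Z) P)
    -- the sequences `N₁` and `M`, indexed by `N₀`
    (N₁ M : ℕ → ℕ)
    (hMlog : Tendsto (fun n : ℕ => (M n : ℝ) * Real.log n / n) atTop (𝓝 0))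
    (hMN : Tendsto (fun n : ℕ => (M n : ℝ) * N₁ n / n) atTop atTop)
    (hM : Tendsto M atTop atTop)
    -- the estimator of `φ`, which may also depend on the target point (its first argument)
    (φhat : E d → Estimator d m N₁)
    (hφhat : ∀ x n, Measurable (fun w : (Fin n → E d) × (Fin (N₁ n) → E d) × E d =>
      φhat x n w.1 w.2.1 w.2.2))
    (p : ℕ) (hp : 1 ≤ p)
    (x : E d) (hx : x ∈ μ₀.support)
    (hasm : (∃ q, 1 ≤ q ∧ q ≤ m ∧
        UniformErrorCondition P μ₀.support μ₁.support φ (φhat x) X Z M p q) ∨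
      OscillationCondition P μ₀.support μ₁.support φ (φhat x) X Z M p)
    (hpos : 0 < f₀ (φ x)) (hc₀ : ContinuousAt f₀ (φ x)) (hc₁ : ContinuousAt f₁ (φ x)) :
    Tendsto (fun n : ℕ => ∫ ω, ratioEst μ₁.support (M n) (fitted (φhat x) X Z n ω)
        (fun i : Fin n => X i ω) (fun j : Fin (N₁ n) => Z j ω) x ^ p ∂P)
      atTop (𝓝 (((f₁ (φ x) / f₀ (φ x) : ℝ≥0) : ℝ) ^ p)) := by
  exact mainTheorem5_general hm P μ₀ μ₁ hsupp φ hφ f₀ f₁ hf₀ hf₁ hν₀ hν₁ X Z hX hZ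
    (hindep.precomp (g := Sum.inl) Sum.inl_injective)
    (hindep.precomp (g := Sum.inr) Sum.inr_injective) N₁ M
    (tendsto_div_of_tendsto_mul_log_div hMlog) hMN hM (φhat x) (hφhat x) p hp x hx hasm hpos hc₀ hc₁
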